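/- Let $\mathcal Q$ be a finite bipartite quiver with vertex set $I=I_0\sqcup I_1$, where the vertices in $I_0$ are sinks and those in $I_1$ are sources, and let $\Omega$ be its set of arrows, $h:s(h)\to t(h)$ with $s(h)\in I_1$, $t(h)\in I_0$. Let $w=(w_i,w_i')_{i\in I}$ and $v=(v_i)_{i\in I}$ be vectors of nonnegative integers, and put $W_i=\mathbb C^{w_i}$, $W_i'=\mathbb C^{w_i'}$. Let $$\mathbf E_w=\bigoplus_{\alpha\in I_0}\mathrm{Hom}(W'_\alpha,W_\alpha)\oplus\bigoplus_{\beta\in I_1}\mathrm{Hom}(W_\beta,W'_\beta)\oplus\bigoplus_{h\in\Omega}\mathrm{Hom}(W_{s(h)},W_{t(h)}),$$ with elements $(x_i,y_h)$. For $\alpha\in I_0$ let $A_\alpha: W'_\alpha\oplus\bigoplus_{t(h)=\alpha}W_{s(h)}\to W_\alpha$, $(a,(b_h))\mapsto x_\alpha(a)+\sum_h y_h(b_h)$; for $\beta\in I_1$ let $A_\beta: W_\beta\to W'_\beta\oplus\bigoplus_{s(h)=\beta}W_{t(h)}$, $b\mapsto (x_\beta(b),(y_h(b))_h)$. Define the varieties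 $$\mathbf E_{v,w}=\{\mathrm{rank}\,A_i\le v_i\ \forall i\}\subseteq \mathbf E_w,\qquad \mathbf E^\circ_{v,w}=\{\mathrm{rank}\,A_i=v_i\ \forall i\}\subseteq\mathbf E_w ,$$ $$\mathcal F_{v,w}=\{(X_i)_{i\in I}: \dim X_i=v_i,\ X_\alpha\subseteq W_\alpha\ (\alpha\in I_0),\ X_\beta\subseteq W'_\beta\oplus\textstyle\bigoplus_{s(h)=\beta}X_{t(h)}\ (\beta\in I_1)\},$$ a subvariety of $\prod_{\alpha} Gr(v_\alpha,W_\alpha)\times\prod_\beta Gr(v_\beta,W'_\beta\oplus\bigoplus_{s(h)=\beta}W_{t(h)})$, and $$\tilde{\mathcal F}_{v,w}=\{(x_i,y_h,X_i): (x_i,y_h)\in\mathbf E_w,\ (X_i)\in\mathcal F_{v,w},\ \mathrm{im}\,A_i\subseteq X_i\ \forall i\},$$ with the projection $\pi:\tilde{\mathcal F}_{v,w}\to\mathbf E_{v,w}$, $(x_i,y_h,X_i)\mapsto(x_i,y_h)$. Call $(v,w)$ $l$-dominant if $w_i\ge v_i$ and $w'_i\ge v_i-\sum_{h:i-j}v_j$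 for all $i\in I$, where $h:i-j$ runs over all arrows with one endpoint $i$ and $j$ is the other endpoint. Let $\bar v_i=\min\big(v_i,w_i,w'_i+\sum_{h:i-j}\min(v_j,w_j)\big)$; the vector $\bar v$ is the largest $v'\le v$ such that $(v',w)$ is $l$-dominant. (Here $\le$ is componentwise.) (a) $\mathbf E_{v,w}=\mathbf E_{\bar v,w}$ is irreducible. Moreover $\mathbf E^\circ_{\bar v,w}$ is its largest stratum: it is nonempty and open in $\mathbf E_{v,w}$, and every nonempty $\mathbf E^\circ_{v',w}\subseteq\mathbf E_{v,w}$ has $v'\le\bar v$. Consequently $\mathbf E_{v,w}=\overline{\mathbf E^\circ_{\bar v,w}}$ (Zariski closure in $\mathbf E_w$). (b) Assume $v_\alpha\le w_\alpha$ for all $\alpha\in I_0$ and $v_\beta\le w'_\beta+\sum_{s(h)=\beta}v_{t(h)}$ for all $\beta\in I_1$. Then $\tilde{\mathcal F}_{v,w}$ and $\mathcal F_{v,w}$ are irreducible and nonsingular, and $\pi$ is surjective. Moreover $$\dim\mathcal F_{v,w}=d_{v,w}:=\sum_{\beta\in I_1}\Big(w'_\beta+\sum_{s(h)=\beta}v_{t(h)}-v_\beta\Big)v_\beta+\sum_{\alpha\in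 I_0}(w_\alpha-v_\alpha)v_\alpha=\sum_{\alpha\in I_0}w_\alpha v_\alpha+\sum_{\beta\in I_1}w'_\beta v_\beta-\sum_{i\in I}v_i^2+\sum_{h\in\Omega}v_{s(h)}v_{t(h)},$$ $$\dim\tilde{\mathcal F}_{v,w}=\tilde d_{v,w}:=d_{v,w}+\sum_{\alpha\in I_0}v_\alpha w'_\alpha+\sum_{\beta\in I_1}v_\beta w_\beta=\sum_{\alpha\in I_0}(w_\alpha+w'_\alpha)v_\alpha+\sum_{\beta\in I_1}(w_\beta+w'_\beta)v_\beta-\sum_{i\in I}v_i^2+\sum_{h\in\Omega}v_{s(h)}v_{t(h)},$$ $$\dim\mathbf E_{v,w}=\dim\mathbf E_{\bar v,w}=\tilde d_{\bar v,w}.$$ (c) If $(v,w)$ is $l$-dominant, then $\pi$ is birational, and it restricts to an isomorphism $\pi^{-1}(\mathbf E^\circ_{v,w})\xrightarrow{\ \cong\ }\mathbf E^\circ_{v,w}$. -/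

import Mathlib

open Filter Topology Set

noncomputable section

/-! ### Complex algebraic varieties as spaces with functions -/

/-- A topological space with a sheaf of `ℂ`-algebras of `ℂ`-valued functions.  The sheaf is given
by the relation `RegAt f x`: the function `f` is regular in a neighbourhood of `x` (the values of
`f` away from `x` are irrelevant). A function is regular on an open set `U` if it is regular at
every point of `U`. -/
structure FunctionSpace where
  carrier : Type
  top : TopologicalSpace carrier
  RegAt : (carrier → ℂ) → carrier → Prop
  regAt_congr : ∀ {f g : carrier → ℂ} {x : carrier}, f =ᶠ[𝓝 x] g → RegAt f x → RegAt g x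
  regAt_const : ∀ (c : ℂ) (x : carrier), RegAt (fun _ => c) x
  regAt_add : ∀ {f g : carrier → ℂ} {x : carrier}, RegAt f x → RegAt g x → RegAt (f + g) x
  regAt_mul : ∀ {f g : carrier → ℂ} {x : carrier}, RegAt f x → RegAt g x → RegAt (f * g) x
  regAt_nhds : ∀ {f : carrier → ℂ} {x : carrier}, RegAt f x → ∀ᶠ y in 𝓝 x, RegAt f y

namespace FunctionSpace

instance : CoeSort FunctionSpace Type := ⟨FunctionSpace.carrier⟩

instance (X : FunctionSpace) : TopologicalSpace X := X.top

/-- The local ring of germs of regular functions at `x`. -/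
def stalk (X : FunctionSpace) (x : X) : Subring (Germ (𝓝 x) ℂ) where
  carrier := {g | ∃ f : X → ℂ, X.RegAt f x ∧ g = (f : Germ (𝓝 x) ℂ)}
  zero_mem' := ⟨fun _ => 0, X.regAt_const 0 x, rfl⟩
  one_mem' := ⟨fun _ => 1, X.regAt_const 1 x, rfl⟩
  add_mem' := by
    rintro _ _ ⟨f, hf, rfl⟩ ⟨g, hg, rfl⟩
    exact ⟨f + g, X.regAt_add hf hg, rfl⟩
  mul_mem' := by
    rintro _ _ ⟨f, hf, rfl⟩ ⟨g, hg, rfl⟩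
    exact ⟨f * g, X.regAt_mul hf hg, rfl⟩
  neg_mem' := by
    rintro _ ⟨f, hf, rfl⟩
    refine ⟨(fun _ => -1) * f, X.regAt_mul (X.regAt_const (-1) x) hf, ?_⟩
    rw [← Germ.coe_neg]
    congr 1
    funext y
    simp

/-- Nonsingular: all local rings are regular. -/
def IsNonsingular (X : FunctionSpace) : Prop :=
  ∀ x : X, IsRegularLocalRing (X.stalk x)

/-- The dimension of `X` (its Krull dimension as a topological space) is the integer `d`. -/
def HasDim (X : FunctionSpace) (d : ℤ) : Prop :=
  ∃ n : ℕ, topologicalKrullDim X = n ∧ (n : ℤ) = d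

/-- Morphisms: continuous maps that pull regular functions back to regular functions. -/
def IsMorphism {X Y : FunctionSpace} (φ : X → Y) : Prop :=
  Continuous φ ∧ ∀ (f : Y → ℂ) (x : X), Y.RegAt f (φ x) → X.RegAt (f ∘ φ) x

/-- Isomorphisms. -/
def IsIsomorphism {X Y : FunctionSpace} (φ : X → Y) : Prop :=
  ∃ ψ : Y → X, Function.LeftInverse ψ φ ∧ Function.RightInverse ψ φ ∧
    IsMorphism φ ∧ IsMorphism ψ

/-- A subset with the induced topology; a function on it is regular if it is locally the
restriction of a regular function of the ambient space.  (For a locally closed subset of a variety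
this is its structure of a reduced subvariety.) -/
def sub (X : FunctionSpace) (S : Set X) : FunctionSpace where
  carrier := S
  top := instTopologicalSpaceSubtype
  RegAt f x := ∃ g : X → ℂ, X.RegAt g x.1 ∧ ∀ᶠ y in 𝓝 x, f y = g y.1
  regAt_congr := by
    rintro f f' x h ⟨g, hg, hfg⟩
    refine ⟨g, hg, ?_⟩
    filter_upwards [h, hfg] with y h1 h2
    rw [← h1, h2]
  regAt_const c x := ⟨fun _ => c, X.regAt_const c _, Eventually.of_forall fun _ => rfl⟩
  regAt_add := by
    rintro f f' x ⟨g, hg, h⟩ ⟨g', hg', h'⟩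
    refine ⟨g + g', X.regAt_add hg hg', ?_⟩
    filter_upwards [h, h'] with y h1 h2
    simp [h1, h2]
  regAt_mul := by
    rintro f f' x ⟨g, hg, h⟩ ⟨g', hg', h'⟩
    refine ⟨g * g', X.regAt_mul hg hg', ?_⟩
    filter_upwards [h, h'] with y h1 h2
    simp [h1, h2]
  regAt_nhds := by
    rintro f x ⟨g, hg, h⟩
    have h1 : ∀ᶠ y in 𝓝 x, X.RegAt g y.1 :=
      continuous_subtype_val.continuousAt.eventually (X.regAt_nhds hg)
    filter_upwards [h1, h.eventually_nhds] with y h2 h3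
    exact ⟨g, h2, h3⟩

/-- The quotient structure along a map `q : X → Y`: a set is open if its preimage is, and
a function on an open set is regular if its pull-back to `X` is. -/
def quot (X : FunctionSpace) {Y : Type} (q : X → Y) : FunctionSpace where
  carrier := Y
  top := TopologicalSpace.coinduced q X.top
  RegAt f y := ∀ᶠ y' in @nhds Y (TopologicalSpace.coinduced q X.top) y,
    ∀ x : X, q x = y' → X.RegAt (f ∘ q) x
  regAt_congr := by
    let _ : TopologicalSpace Y := TopologicalSpace.coinduced q X.top
    have hq : Continuous q := continuous_coinduced_rng
    intro f g y h hf
    filter_upwards [hf, h.eventually_nhds] with y' h1 h2 x hx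
    subst hx
    exact X.regAt_congr (hq.continuousAt.eventually h2) (h1 x rfl)
  regAt_const c y := Eventually.of_forall fun _ x _ => X.regAt_const c x
  regAt_add := by
    intro f g y hf hg
    filter_upwards [hf, hg] with y' h1 h2 x hx
    exact X.regAt_add (h1 x hx) (h2 x hx)
  regAt_mul := by
    intro f g y hf hg
    filter_upwards [hf, hg] with y' h1 h2 x hx
    exact X.regAt_mul (h1 x hx) (h2 x hx)
  regAt_nhds := by
    let _ : TopologicalSpace Y := TopologicalSpace.coinduced q X.top
    intro f y hf
    exact Filter.Eventually.eventually_nhds hf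

/-- `φ` is birational: it is a morphism that restricts to an isomorphism between dense open
subsets of `X` and `Y`. -/
def IsBirational {X Y : FunctionSpace} (φ : X → Y) : Prop :=
  IsMorphism φ ∧ ∃ (U : Set X) (V : Set Y) (h : MapsTo φ U V),
    IsOpen U ∧ Dense U ∧ IsOpen V ∧ Dense V ∧
    IsIsomorphism (X := X.sub U) (Y := Y.sub V) (h.restrict φ U V)

end FunctionSpace

/-- Polynomial functions on a complex vector space: the algebra of functions generated by the
linear functionals. -/
def polyFun (V : Type) [AddCommGroup V] [Module ℂ V] : Subalgebra ℂ (V → ℂ) :=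
  Algebra.adjoin ℂ {f | ∃ φ : Module.Dual ℂ V, f = fun x => φ x}

/-- The Zariski topology on a complex vector space, with the sets `{p ≠ 0}`, `p` a polynomial
function, as basis of open sets. -/
abbrev zariskiTopology (V : Type) [AddCommGroup V] [Module ℂ V] : TopologicalSpace V :=
  TopologicalSpace.generateFrom {U | ∃ p ∈ polyFun V, U = {x | p x ≠ 0}}

/-- A (finite-dimensional) complex vector space as an affine space: Zariski topology, and the
regular functions are locally quotients of polynomial functions. -/
def affineSpace (V : Type) [AddCommGroup V] [Module ℂ V] : FunctionSpace where
  carrier := V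
  top := zariskiTopology V
  RegAt f x := ∃ p ∈ polyFun V, ∃ q ∈ polyFun V, q x ≠ 0 ∧
    ∀ᶠ y in @nhds V (zariskiTopology V) x, f y = p y / q y
  regAt_congr := by
    rintro f g x h ⟨p, hp, q, hq, hx, hf⟩
    refine ⟨p, hp, q, hq, hx, ?_⟩
    filter_upwards [h, hf] with y h1 h2
    rw [← h1, h2]
  regAt_const c x :=
    ⟨fun _ => c, (polyFun V).algebraMap_mem c, 1, (polyFun V).one_mem, by simp,
      Eventually.of_forall fun _ => by simp⟩
  regAt_add := by
    let _ : TopologicalSpace V := zariskiTopology V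
    rintro f g x ⟨p, hp, q, hq, hx, hf⟩ ⟨p', hp', q', hq', hx', hg⟩
    have h0 : ∀ᶠ y in 𝓝 x, q y ≠ 0 :=
      (TopologicalSpace.isOpen_generateFrom_of_mem ⟨q, hq, rfl⟩ :
        IsOpen {x | q x ≠ 0}).mem_nhds hx
    have h0' : ∀ᶠ y in 𝓝 x, q' y ≠ 0 :=
      (TopologicalSpace.isOpen_generateFrom_of_mem ⟨q', hq', rfl⟩ :
        IsOpen {x | q' x ≠ 0}).mem_nhds hx'
    refine ⟨p * q' + q * p', add_mem (mul_mem hp hq') (mul_mem hq hp'), q * q', mul_mem hq hq',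
      mul_ne_zero hx hx', ?_⟩
    filter_upwards [hf, hg, h0, h0'] with y h1 h2 h3 h4
    simp only [Pi.add_apply, Pi.mul_apply, h1, h2]
    exact div_add_div _ _ h3 h4
  regAt_mul := by
    rintro f g x ⟨p, hp, q, hq, hx, hf⟩ ⟨p', hp', q', hq', hx', hg⟩
    refine ⟨p * p', mul_mem hp hp', q * q', mul_mem hq hq', mul_ne_zero hx hx', ?_⟩
    filter_upwards [hf, hg] with y h1 h2
    simp only [Pi.mul_apply, h1, h2]
    exact div_mul_div_comm _ _ _ _
  regAt_nhds := by
    let _ : TopologicalSpace V := zariskiTopology V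
    rintro f x ⟨p, hp, q, hq, hx, hf⟩
    have h0 : ∀ᶠ y in 𝓝 x, q y ≠ 0 :=
      (TopologicalSpace.isOpen_generateFrom_of_mem ⟨q, hq, rfl⟩ :
        IsOpen {x | q x ≠ 0}).mem_nhds hx
    filter_upwards [h0, hf.eventually_nhds] with y h1 h2
    exact ⟨p, hp, q, hq, h1, h2⟩

section Grassmannian

variable {ι : Type} (E : ι → Type) [∀ i, AddCommGroup (E i)] [∀ i, Module ℂ (E i)] (d : ι → ℕ)

/-- Families of `d i`-dimensional subspaces of `E i`. -/
abbrev GrPoint : Type :=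
  {X : ∀ i, Submodule ℂ (E i) // ∀ i, Module.finrank ℂ (X i) = d i}

/-- Families of linear maps `ℂ ^ (d i) → E i`. -/
abbrev FrameMaps : Type := ∀ i, (Fin (d i) → ℂ) →ₗ[ℂ] E i

variable {E d} in
/-- The family of subspaces spanned by a family of frames. -/
def FrameMaps.span (a : FrameMaps E d) (ha : ∀ i, Function.Injective (a i)) : GrPoint E d :=
  ⟨fun i => LinearMap.range (a i), fun i => by
    rw [LinearMap.finrank_range_of_inj (ha i), Module.finrank_fin_fun]⟩

/-- The product of Grassmannians `∏ i, Gr(d i, E i)`: the quotient of the open subset of families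
of injective maps (frames) in the affine space of all families of linear maps `ℂ ^ (d i) → E i`
by change of frames. -/
def grassmannians : FunctionSpace :=
  ((affineSpace (FrameMaps E d)).sub
      {a : FrameMaps E d | ∀ i, Function.Injective (a i)}).quot
    (Y := GrPoint E d) fun a => FrameMaps.span (E := E) (d := d) a.1 a.2

/-- The product variety `V × ∏ i, Gr(d i, E i)` with an affine space `V`, as the quotient of
`V × {families of frames}` by change of frames. -/
def affineProdGrassmannians (V : Type) [AddCommGroup V] [Module ℂ V] : FunctionSpace :=
  ((affineSpace (V × FrameMaps E d)).sub
      {z : V × FrameMaps E d | ∀ i, Function.Injective (z.2 i)}).quot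
    (Y := V × GrPoint E d) fun z => (z.1.1, FrameMaps.span (E := E) (d := d) z.1.2 z.2)

end Grassmannian

/-! ### Graded quiver varieties of a bipartite quiver

A bipartite quiver has vertex set `I = I₀ ⊕ I₁`, with sinks `I₀` and sources `I₁`, and
`Ω β α` is the set of arrows from the source `β : I₁` to the sink `α : I₀`.
The dimension vectors are `w = (w i, w' i)` and `v = (v i)`, with `W i = ℂ ^ (w i)` and
`W' i = ℂ ^ (w' i)`. -/

namespace GradedQuiver

variable {I₀ I₁ : Type} [Fintype I₀] [Fintype I₁]
  (Ω : I₁ → I₀ → Type) [∀ β α, Fintype (Ω β α)]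
  (v w w' : I₀ ⊕ I₁ → ℕ)

/-- The arrows with source `β`. -/
abbrev ArrowsFrom (β : I₁) : Type := Σ α : I₀, Ω β α

/-- The arrows with target `α`. -/
abbrev ArrowsTo (α : I₀) : Type := Σ β : I₁, Ω β α

/-- The representation space `E_w` of the decorated quiver: `x_α : W'_α → W_α` for sinks,
`x_β : W_β → W'_β` for sources, `y_h : W_β → W_α` for arrows `h : β → α`. -/
abbrev Rep : Type :=
  (∀ α : I₀, (Fin (w' (.inl α)) → ℂ) →ₗ[ℂ] (Fin (w (.inl α)) → ℂ)) ×
  (∀ β : I₁, (Fin (w (.inr β)) → ℂ) →ₗ[ℂ] (Fin (w' (.inr β)) → ℂ)) ×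
  (∀ (β : I₁) (α : I₀), Ω β α → ((Fin (w (.inr β)) → ℂ) →ₗ[ℂ] (Fin (w (.inl α)) → ℂ)))

/-- The target of `A_i`: `W_α` for a sink `α`, and `W'_β ⊕ ⨁_{h : β → α} W_α` for a source `β`. -/
abbrev Target : I₀ ⊕ I₁ → Type
  | .inl α => Fin (w (.inl α)) → ℂ
  | .inr β => (Fin (w' (.inr β)) → ℂ) × (∀ h : ArrowsFrom Ω β, Fin (w (.inl h.1)) → ℂ)

instance : ∀ i, AddCommGroup (Target Ω w w' i)
  | .inl α => inferInstanceAs (AddCommGroup (Fin (w (.inl α)) → ℂ))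
  | .inr β => inferInstanceAs
      (AddCommGroup ((Fin (w' (.inr β)) → ℂ) × (∀ h : ArrowsFrom Ω β, Fin (w (.inl h.1)) → ℂ)))

instance : ∀ i, Module ℂ (Target Ω w w' i)
  | .inl α => inferInstanceAs (Module ℂ (Fin (w (.inl α)) → ℂ))
  | .inr β => inferInstanceAs
      (Module ℂ ((Fin (w' (.inr β)) → ℂ) × (∀ h : ArrowsFrom Ω β, Fin (w (.inl h.1)) → ℂ)))

instance : ∀ i, FiniteDimensional ℂ (Target Ω w w' i)
  | .inl α => inferInstanceAs (FiniteDimensional ℂ (Fin (w (.inl α)) → ℂ))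
  | .inr β => inferInstanceAs (FiniteDimensional ℂ
      ((Fin (w' (.inr β)) → ℂ) × (∀ h : ArrowsFrom Ω β, Fin (w (.inl h.1)) → ℂ)))

variable {Ω w w'}

/-- `A_α : W'_α ⊕ ⨁_{h : β → α} W_β → W_α`, `(a, b) ↦ x_α a + ∑ y_h b_h`, for a sink `α`. -/
def sinkMap (r : Rep Ω w w') (α : I₀) :
    ((Fin (w' (.inl α)) → ℂ) × (∀ h : ArrowsTo Ω α, Fin (w (.inr h.1)) → ℂ)) →ₗ[ℂ]
      (Fin (w (.inl α)) → ℂ) :=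
  LinearMap.coprod (r.1 α)
    (∑ h : ArrowsTo Ω α, (r.2.2 h.1 α h.2).comp (LinearMap.proj h))

/-- `A_β : W_β → W'_β ⊕ ⨁_{h : β → α} W_α`, `b ↦ (x_β b, (y_h b)_h)`, for a source `β`. -/
def sourceMap (r : Rep Ω w w') (β : I₁) :
    (Fin (w (.inr β)) → ℂ) →ₗ[ℂ]
      (Fin (w' (.inr β)) → ℂ) × (∀ h : ArrowsFrom Ω β, Fin (w (.inl h.1)) → ℂ) :=
  LinearMap.prod (r.2.1 β) (LinearMap.pi fun h : ArrowsFrom Ω β => r.2.2 β h.1 h.2)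

/-- The image of `A_i`. -/
def imA (r : Rep Ω w w') : ∀ i, Submodule ℂ (Target Ω w w' i)
  | .inl α => LinearMap.range (sinkMap r α)
  | .inr β => LinearMap.range (sourceMap r β)

/-- The rank of `A_i`. -/
def rankA (r : Rep Ω w w') (i : I₀ ⊕ I₁) : ℕ := Module.finrank ℂ (imA r i)

variable (Ω w w')

/-- `E_w` as a variety (an affine space). -/
def repSpace : FunctionSpace := affineSpace (Rep Ω w w')

/-- The points of `E_{v,w}`: `rank A_i ≤ v_i` for all `i`. -/
def affineSet : Set (repSpace Ω w w') := {r : Rep Ω w w' | ∀ i, rankA r i ≤ v i}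

/-- The stratum `E°_{v,w}`: `rank A_i = v_i` for all `i`. -/
def stratum : Set (repSpace Ω w w') := {r : Rep Ω w w' | ∀ i, rankA r i = v i}

/-- The affine graded quiver variety `E_{v,w}`. -/
def affineVariety : FunctionSpace := (repSpace Ω w w').sub (affineSet Ω v w w')

variable {Ω v w w'} in
/-- The condition `X_β ⊆ W'_β ⊕ ⨁_{h : β → α} X_α` for all sources `β`. -/
def IsFlag (X : GrPoint (Target Ω w w') v) : Prop :=
  ∀ (β : I₁), ∀ z ∈ X.1 (.inr β), ∀ h : ArrowsFrom Ω β, z.2 h ∈ X.1 (.inl h.1)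

/-- The projective variety `F_{v,w}`, a subvariety of
`∏_α Gr(v_α, W_α) × ∏_β Gr(v_β, W'_β ⊕ ⨁_{h : β → α} W_α)`. -/
def flagVariety : FunctionSpace :=
  (grassmannians (Target Ω w w') v).sub {X : GrPoint (Target Ω w w') v | IsFlag X}

/-- The points `(x, y, X)` of `F̃_{v,w}`. -/
def nonsingularSet : Set (affineProdGrassmannians (Target Ω w w') v (Rep Ω w w')) :=
  {z : Rep Ω w w' × GrPoint (Target Ω w w') v | IsFlag z.2 ∧ ∀ i, imA z.1 i ≤ z.2.1 i}

/-- Nakajima's nonsingular graded quiver variety `F̃_{v,w}`, a subvariety of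
`E_w × ∏_α Gr(v_α, W_α) × ∏_β Gr(v_β, W'_β ⊕ ⨁_{h : β → α} W_α)`. -/
def nonsingularVariety : FunctionSpace :=
  (affineProdGrassmannians (Target Ω w w') v (Rep Ω w w')).sub (nonsingularSet Ω v w w')

/-- The projection `π : F̃_{v,w} → E_{v,w}`, `(x, y, X) ↦ (x, y)`. -/
def proj (z : nonsingularVariety Ω v w w') : affineVariety Ω v w w' :=
  ⟨z.1.1, fun i => (Submodule.finrank_mono (z.2.2 i)).trans_eq (z.1.2.2 i)⟩

/-- The condition for `F_{v,w}` to be nonempty: `v_α ≤ w_α` for sinks `α`, and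
`v_β ≤ w'_β + ∑_{h : β → α} v_α` for sources `β`. -/
def NonemptyCondition : Prop :=
  (∀ α : I₀, v (.inl α) ≤ w (.inl α)) ∧
  ∀ β : I₁, v (.inr β) ≤ w' (.inr β) + ∑ h : ArrowsFrom Ω β, v (.inl h.1)

/-- The sum of `u_j` over all arrows joining `i` to some vertex `j`. -/
def adjSum (u : I₀ ⊕ I₁ → ℕ) : I₀ ⊕ I₁ → ℕ
  | .inl α => ∑ h : ArrowsTo Ω α, u (.inr h.1)
  | .inr β => ∑ h : ArrowsFrom Ω β, u (.inl h.1)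

/-- `(v, w)` is `l`-dominant: `w_i ≥ v_i` and `w'_i ≥ v_i - ∑_{h : i - j} v_j` for all `i`. -/
def LDominant : Prop :=
  ∀ i, (v i : ℤ) ≤ w i ∧ (v i : ℤ) - (adjSum Ω v i : ℤ) ≤ w' i

/-- `v̄_i = min(v_i, w_i, w'_i + ∑_{h : i - j} min(v_j, w_j))`. -/
def vbar (i : I₀ ⊕ I₁) : ℕ :=
  min (v i) (min (w i) (w' i + adjSum Ω (fun j => min (v j) (w j)) i))

/-- `d_{v,w}`. -/
def dimF : ℤ :=
  ∑ β : I₁, ((w' (.inr β) : ℤ) + ∑ h : ArrowsFrom Ω β, (v (.inl h.1) : ℤ) - v (.inr β))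
      * v (.inr β)
    + ∑ α : I₀, ((w (.inl α) : ℤ) - v (.inl α)) * v (.inl α)

/-- `d̃_{v,w}`. -/
def dimFtilde : ℤ :=
  dimF Ω v w w' + ∑ α : I₀, (v (.inl α) : ℤ) * w' (.inl α)
    + ∑ β : I₁, (v (.inr β) : ℤ) * w (.inr β)

end GradedQuiver

end

/-!
A flag `X` is obtained by choosing first the spaces `X_α` and then the subspaces
`X_β ⊆ W'_β ⊕ ⨁ X_α`, so `F_{v,w}` is an iterated bundle of Grassmannians. A representation amounts
to the family of the maps `x_α` and `A_β`, and the condition `im A_i ⊆ X_i` for all `i` says exactly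
that these maps have values in the `X_i`; hence `F̃_{v,w}` is a vector bundle over `F_{v,w}`.
Frames of the `X_i` together with retractions give charts by affine spaces, and irreducibility
follows because the space of all frames is an open subset of an affine space.

The ranks of the `A_i` of a representation always form an `l`-dominant vector, so
`E_{v,w} = E_{v̄,w}`. The projection `π` is surjective because the images `im A_i` can be
enlarged to a flag of dimension `v`. Over the open stratum `X_i = im A_i` is forced, and it depends
regularly on the representation, since locally `A_i ∘ j` is a frame of `im A_i` for a fixed map `j`.
So `π` is birational in the `l`-dominant case, and `dim E_{v,w} = dim F̃_{v̄,w}`.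
-/

namespace FunctionSpace

/-- Regular functions that do not vanish at a point are invertible near that point. -/
class IsLocallyRinged (X : FunctionSpace) : Prop where
  regAt_inv : ∀ {f : X → ℂ} {x : X}, X.RegAt f x → f x ≠ 0 → X.RegAt (fun y => (f y)⁻¹) x
  eventually_ne : ∀ {f : X → ℂ} {x : X}, X.RegAt f x → f x ≠ 0 → ∀ᶠ y in 𝓝 x, f y ≠ 0

/-- `φ` is a morphism near the point `x`. -/
def IsMorphismAt {X Y : FunctionSpace} (φ : X → Y) (x : X) : Prop :=
  ContinuousAt φ x ∧ ∀ f : Y → ℂ, Y.RegAt f (φ x) → X.RegAt (f ∘ φ) x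

theorem isMorphism_iff {X Y : FunctionSpace} {φ : X → Y} :
    IsMorphism φ ↔ ∀ x, IsMorphismAt φ x :=
  ⟨fun h x => ⟨h.1.continuousAt, fun f => h.2 f x⟩,
    fun h => ⟨continuous_iff_continuousAt.2 fun x => (h x).1, fun f x => (h x).2 f⟩⟩

/-- The quotient map `q`, as a map to the quotient structure along `q`. -/
def toQuot {X : FunctionSpace} {Q : Type} (q : X → Q) : X → X.quot q := q

theorem continuous_toQuot {X : FunctionSpace} {Q : Type} (q : X → Q) :
    Continuous (toQuot q) :=
  continuous_iff_coinduced_le.2 le_rfl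

theorem isOpen_quot_iff {X : FunctionSpace} {Q : Type} {q : X → Q} {O : Set (X.quot q)} :
    IsOpen O ↔ IsOpen (toQuot q ⁻¹' O) := Iff.rfl

theorem regAt_quot_iff {X : FunctionSpace} {Q : Type} {q : X → Q} {f : X.quot q → ℂ}
    {y : X.quot q} :
    (X.quot q).RegAt f y ↔
      ∀ᶠ y' in 𝓝 y, ∀ x : X, toQuot q x = y' → X.RegAt (fun x => f (toQuot q x)) x := Iff.rfl

theorem regAt_affineSpace_iff {V : Type} [AddCommGroup V] [Module ℂ V] {f : affineSpace V → ℂ}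
    {x : affineSpace V} :
    (affineSpace V).RegAt f x ↔ ∃ p : affineSpace V → ℂ, p ∈ polyFun V ∧
      ∃ q : affineSpace V → ℂ, q ∈ polyFun V ∧ q x ≠ 0 ∧ ∀ᶠ y in 𝓝 x, f y = p y / q y := Iff.rfl

theorem isOpen_polyFun_ne_zero {V : Type} [AddCommGroup V] [Module ℂ V] {p : affineSpace V → ℂ}
    (hp : p ∈ polyFun V) : IsOpen {x : affineSpace V | p x ≠ 0} :=
  TopologicalSpace.isOpen_generateFrom_of_mem ⟨p, hp, rfl⟩

namespace IsMorphismAt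

variable {X Y Z : FunctionSpace}

theorem comp {ψ : Y → Z} {φ : X → Y} {x : X} (hψ : IsMorphismAt ψ (φ x)) (hφ : IsMorphismAt φ x) :
    IsMorphismAt (fun y => ψ (φ y)) x :=
  ⟨ContinuousAt.comp (f := φ) hψ.1 hφ.1, fun f hf => hφ.2 _ (hψ.2 f hf)⟩

theorem congr {φ ψ : X → Y} {x : X} (h : IsMorphismAt φ x) (e : φ =ᶠ[𝓝 x] ψ) :
    IsMorphismAt ψ x := by
  have hx : φ x = ψ x := e.self_of_nhds
  refine ⟨h.1.congr e, fun f hf => ?_⟩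
  rw [← hx] at hf
  refine X.regAt_congr ?_ (h.2 f hf)
  filter_upwards [e] with y hy
  simp [hy]

theorem subVal (S : Set X) (x : X.sub S) :
    IsMorphismAt (X := X.sub S) (Y := X) Subtype.val x :=
  ⟨continuous_subtype_val.continuousAt, fun f hf => ⟨f, hf, Eventually.of_forall fun _ => rfl⟩⟩

theorem codRestrict {S : Set Y} {φ : X → Y.sub S} {x : X}
    (h : IsMorphismAt (X := X) (Y := Y) (fun y => (φ y).1) x) : IsMorphismAt φ x := by
  have hc : ContinuousAt φ x := by
    exact IsInducing.subtypeVal.continuousAt_iff.2 h.1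
  refine ⟨hc, ?_⟩
  rintro f ⟨g, hg, hfg⟩
  refine X.regAt_congr ?_ (h.2 g hg)
  filter_upwards [hc.eventually hfg] with y hy
  exact hy.symm

theorem toQuot {Q : Type} (q : X → Q) (x : X) : IsMorphismAt (toQuot q) x :=
  ⟨(continuous_toQuot q).continuousAt, fun _ hf => (regAt_quot_iff.1 hf).self_of_nhds x rfl⟩

theorem quotLift {Q : Type} {q : X → Q} {O : Set (X.quot q)} (hO : IsOpen O)
    {φ : X.quot q → Z}
    (h : ∀ x : X, FunctionSpace.toQuot q x ∈ O →
      IsMorphismAt (fun y => φ (FunctionSpace.toQuot q y)) x)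
    {y : X.quot q} (hy : y ∈ O) : IsMorphismAt φ y := by
  have hq := continuous_toQuot q
  have hc : ∀ y ∈ O, ContinuousAt φ y := by
    have : ContinuousOn φ O := by
      rw [continuousOn_open_iff hO]
      intro N hN
      rw [isOpen_quot_iff, isOpen_iff_mem_nhds]
      rintro x ⟨hx, hxN⟩
      exact Filter.inter_mem (hq.continuousAt.preimage_mem_nhds (hO.mem_nhds hx))
        ((h x hx).1 (hN.mem_nhds hxN))
    exact fun y hy => this.continuousAt (hO.mem_nhds hy)
  refine ⟨hc y hy, fun f hf => ?_⟩
  rw [regAt_quot_iff]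
  filter_upwards [(hc y hy).eventually (Z.regAt_nhds hf), hO.mem_nhds hy] with y' h2 h3 x hx
  subst hx
  exact (h x h3).2 f h2

end IsMorphismAt

instance {X : FunctionSpace} [IsLocallyRinged X] (S : Set X) : IsLocallyRinged (X.sub S) where
  regAt_inv := by
    rintro f x ⟨g, hg, h⟩ hx
    refine ⟨fun y => (g y)⁻¹, IsLocallyRinged.regAt_inv hg ?_, ?_⟩
    · rwa [← h.self_of_nhds]
    · filter_upwards [h] with y hy
      rw [hy]
  eventually_ne := by
    rintro f x ⟨g, hg, h⟩ hx
    have h1 : g x.1 ≠ 0 := by rwa [← h.self_of_nhds]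
    have h2 : ∀ᶠ y : X.sub S in 𝓝 x, g y.1 ≠ 0 :=
      (IsMorphismAt.subVal S x).1.eventually (IsLocallyRinged.eventually_ne hg h1)
    filter_upwards [h, h2] with y hy h3
    rwa [hy]

instance (V : Type) [AddCommGroup V] [Module ℂ V] : IsLocallyRinged (affineSpace V) where
  regAt_inv := by
    intro f x hf hx
    rw [regAt_affineSpace_iff] at hf ⊢
    obtain ⟨p, hp, q, hq, hqx, h⟩ := hf
    refine ⟨q, hq, p, hp, ?_, ?_⟩
    · rw [h.self_of_nhds] at hx
      exact (div_ne_zero_iff.1 hx).1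
    · filter_upwards [h] with y hy
      rw [hy, inv_div]
  eventually_ne := by
    intro f x hf hx
    obtain ⟨p, hp, q, hq, hqx, h⟩ := regAt_affineSpace_iff.1 hf
    rw [h.self_of_nhds] at hx
    filter_upwards [h, (isOpen_polyFun_ne_zero hp).mem_nhds (div_ne_zero_iff.1 hx).1,
      (isOpen_polyFun_ne_zero hq).mem_nhds hqx] with y h1 h2 h3
    rw [h1]
    exact div_ne_zero h2 h3

/-! ### Regular maps to vector spaces -/

section RegMap

variable (X : FunctionSpace) {M M₁ M₂ M₃ : Type} [AddCommGroup M] [Module ℂ M]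
  [AddCommGroup M₁] [Module ℂ M₁] [AddCommGroup M₂] [Module ℂ M₂] [AddCommGroup M₃] [Module ℂ M₃]

/-- The map `Ψ` to a vector space is regular near `x`. -/
def RegMapAt (Ψ : X → M) (x : X) : Prop :=
  ∀ φ : Module.Dual ℂ M, X.RegAt (fun y => φ (Ψ y)) x

variable {X}

theorem regAt_sum {ι : Type*} (s : Finset ι) {f : ι → X → ℂ} {x : X}
    (h : ∀ i ∈ s, X.RegAt (f i) x) : X.RegAt (fun y => ∑ i ∈ s, f i y) x := by
  classical
  induction s using Finset.induction_on with
  | empty => simpa using X.regAt_const 0 x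
  | insert i s hi ih =>
    simp only [Finset.sum_insert hi]
    exact X.regAt_add (h i (by simp)) (ih fun j hj => h j (by simp [hj]))

theorem regAt_prod {ι : Type*} (s : Finset ι) {f : ι → X → ℂ} {x : X}
    (h : ∀ i ∈ s, X.RegAt (f i) x) : X.RegAt (fun y => ∏ i ∈ s, f i y) x := by
  classical
  induction s using Finset.induction_on with
  | empty => simpa using X.regAt_const 1 x
  | insert i s hi ih =>
    simp only [Finset.prod_insert hi]
    exact X.regAt_mul (h i (by simp)) (ih fun j hj => h j (by simp [hj]))

theorem IsMorphismAt.regMapAt {Y : FunctionSpace} {φ : X → Y} {x : X} (h : IsMorphismAt φ x)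
    {Ψ : Y → M} (hΨ : Y.RegMapAt Ψ (φ x)) : X.RegMapAt (fun y => Ψ (φ y)) x :=
  fun l => h.2 _ (hΨ l)

theorem regMapAt_id (x : M) : (affineSpace M).RegMapAt (fun y : M => y) x := fun φ =>
  ⟨fun y => φ y, Algebra.subset_adjoin ⟨φ, rfl⟩, 1, (polyFun M).one_mem, by simp,
    Eventually.of_forall fun _ => by simp⟩

namespace RegMapAt

variable {x : X}

theorem const (m : M) (x : X) : X.RegMapAt (fun _ => m) x := fun φ => X.regAt_const (φ m) x

theorem linear {Ψ : X → M₁} (h : X.RegMapAt Ψ x) (l : M₁ →ₗ[ℂ] M₂) :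
    X.RegMapAt (fun y => l (Ψ y)) x := fun φ => h (φ.comp l)

theorem add {Ψ Ψ' : X → M} (h : X.RegMapAt Ψ x) (h' : X.RegMapAt Ψ' x) :
    X.RegMapAt (fun y => Ψ y + Ψ' y) x := fun φ => by
  simp only [map_add]
  exact X.regAt_add (h φ) (h' φ)

theorem of_regAt {f : X → ℂ} (h : X.RegAt f x) : X.RegMapAt f x := fun φ => by
  have : (fun y => φ (f y)) = (fun _ => φ 1) * f := by
    funext y
    have := φ.map_smul (f y) 1
    simp only [smul_eq_mul, mul_one] at this
    simp [this, mul_comm]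
  rw [this]
  exact X.regAt_mul (X.regAt_const _ _) h

theorem congr {Ψ Ψ' : X → M} (h : X.RegMapAt Ψ x) (e : Ψ =ᶠ[𝓝 x] Ψ') : X.RegMapAt Ψ' x :=
  fun φ => X.regAt_congr (e.mono fun y hy => by simp [hy]) (h φ)

theorem smul {f : X → ℂ} {Ψ : X → M} (hf : X.RegAt f x) (h : X.RegMapAt Ψ x) :
    X.RegMapAt (fun y => f y • Ψ y) x := fun φ => by
  simp only [map_smul, smul_eq_mul]
  exact X.regAt_mul hf (h φ)

theorem sum {ι : Type*} (s : Finset ι) {Ψ : ι → X → M} (h : ∀ i ∈ s, X.RegMapAt (Ψ i) x) :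
    X.RegMapAt (fun y => ∑ i ∈ s, Ψ i y) x := fun φ => by
  simpa using regAt_sum s fun i hi => h i hi φ

theorem bilinear [FiniteDimensional ℂ M₁] {Ψ₁ : X → M₁} {Ψ₂ : X → M₂}
    (B : M₁ →ₗ[ℂ] M₂ →ₗ[ℂ] M₃) (h₁ : X.RegMapAt Ψ₁ x) (h₂ : X.RegMapAt Ψ₂ x) :
    X.RegMapAt (fun y => B (Ψ₁ y) (Ψ₂ y)) x := by
  let b := Module.finBasis ℂ M₁
  have : (fun y => B (Ψ₁ y) (Ψ₂ y)) = fun y => ∑ i, b.coord i (Ψ₁ y) • B (b i) (Ψ₂ y) := by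
    funext y
    conv_lhs => rw [← b.sum_repr (Ψ₁ y), map_sum, LinearMap.sum_apply]
    exact Finset.sum_congr rfl fun i _ => by simp
  rw [this]
  exact sum _ fun i _ => smul (h₁ (b.coord i)) (h₂.linear (B (b i)))

theorem prodMk {Ψ₁ : X → M₁} {Ψ₂ : X → M₂} (h₁ : X.RegMapAt Ψ₁ x) (h₂ : X.RegMapAt Ψ₂ x) :
    X.RegMapAt (fun y => (Ψ₁ y, Ψ₂ y)) x := by
  have := (h₁.linear (LinearMap.inl ℂ M₁ M₂)).add (h₂.linear (LinearMap.inr ℂ M₁ M₂))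
  simpa using this

theorem pi {ι : Type} [Finite ι] {N : ι → Type} [∀ i, AddCommGroup (N i)] [∀ i, Module ℂ (N i)]
    {Ψ : X → ∀ i, N i} (h : ∀ i, X.RegMapAt (fun y => Ψ y i) x) : X.RegMapAt Ψ x := by
  classical
  have := Fintype.ofFinite ι
  have h2 := sum Finset.univ fun i _ => (h i).linear (LinearMap.single ℂ N i)
  refine h2.congr (Eventually.of_forall fun y => ?_)
  funext j
  simp [Finset.sum_apply]

theorem linComp [FiniteDimensional ℂ M₂] [FiniteDimensional ℂ M₃]
    {Ψ₁ : X → (M₂ →ₗ[ℂ] M₃)} {Ψ₂ : X → (M₁ →ₗ[ℂ] M₂)}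
    (h₁ : X.RegMapAt Ψ₁ x) (h₂ : X.RegMapAt Ψ₂ x) :
    X.RegMapAt (fun y => (Ψ₁ y).comp (Ψ₂ y)) x :=
  bilinear (LinearMap.llcomp ℂ M₁ M₂ M₃) h₁ h₂

theorem linPi {ι : Type} [Finite ι] {N : ι → Type} [∀ i, AddCommGroup (N i)]
    [∀ i, Module ℂ (N i)] [∀ i, FiniteDimensional ℂ (N i)] {Ψ : X → ∀ i, M →ₗ[ℂ] N i}
    (h : ∀ i, X.RegMapAt (fun y => Ψ y i) x) :
    X.RegMapAt (fun y => LinearMap.pi (Ψ y)) x := by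
  classical
  have := Fintype.ofFinite ι
  refine (sum Finset.univ fun i _ => linComp (const (LinearMap.single ℂ N i) x) (h i)).congr
    (Eventually.of_forall fun y => ?_)
  ext m j
  simp [LinearMap.sum_apply, Finset.sum_apply]

theorem linProd [FiniteDimensional ℂ M₁] [FiniteDimensional ℂ M₂]
    {Ψ₁ : X → (M →ₗ[ℂ] M₁)} {Ψ₂ : X → (M →ₗ[ℂ] M₂)}
    (h₁ : X.RegMapAt Ψ₁ x) (h₂ : X.RegMapAt Ψ₂ x) :
    X.RegMapAt (fun y => (Ψ₁ y).prod (Ψ₂ y)) x := by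
  refine ((linComp (const (LinearMap.inl ℂ M₁ M₂) x) h₁).add
    (linComp (const (LinearMap.inr ℂ M₁ M₂) x) h₂)).congr (Eventually.of_forall fun y => ?_)
  ext m <;> simp

theorem apply {ι : Type} {N : ι → Type} [∀ i, AddCommGroup (N i)] [∀ i, Module ℂ (N i)]
    {Ψ : X → ∀ i, N i} (h : X.RegMapAt Ψ x) (i : ι) : X.RegMapAt (fun y => Ψ y i) x :=
  h.linear (LinearMap.proj i)

theorem fst {Ψ : X → M₁ × M₂} (h : X.RegMapAt Ψ x) : X.RegMapAt (fun y => (Ψ y).1) x :=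
  h.linear (LinearMap.fst ℂ M₁ M₂)

theorem snd {Ψ : X → M₁ × M₂} (h : X.RegMapAt Ψ x) : X.RegMapAt (fun y => (Ψ y).2) x :=
  h.linear (LinearMap.snd ℂ M₁ M₂)

theorem comp_polyFun {Ψ : X → M} (h : X.RegMapAt Ψ x) {p : M → ℂ} (hp : p ∈ polyFun M) :
    X.RegAt (fun y => p (Ψ y)) x := by
  induction hp using Algebra.adjoin_induction with
  | mem p hp =>
    obtain ⟨φ, rfl⟩ := hp
    exact h φ
  | algebraMap c => exact X.regAt_const c x
  | add p q _ _ hp hq => exact X.regAt_add hp hq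
  | mul p q _ _ hp hq => exact X.regAt_mul hp hq

theorem isMorphismAt [IsLocallyRinged X] {Ψ : X → affineSpace M} (h : X.RegMapAt (M := M) Ψ x) :
    IsMorphismAt (Y := affineSpace M) Ψ x := by
  have hc : ContinuousAt Ψ x := by
    rw [ContinuousAt]
    refine TopologicalSpace.tendsto_nhds_generateFrom_iff.2 ?_
    rintro _ ⟨p, hp, rfl⟩ hx
    exact IsLocallyRinged.eventually_ne (h.comp_polyFun hp) hx
  refine ⟨hc, ?_⟩
  rintro f ⟨p, hp, q, hq, hx, hf⟩
  refine X.regAt_congr ?_ (X.regAt_mul (h.comp_polyFun hp)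
    (IsLocallyRinged.regAt_inv (h.comp_polyFun hq) hx))
  filter_upwards [hc.eventually hf] with y hy
  simp only [Function.comp, hy, Pi.mul_apply, div_eq_mul_inv]

theorem det {n : Type} [Fintype n] [DecidableEq n] {A : X → Matrix n n ℂ}
    (h : X.RegMapAt A x) : X.RegAt (fun y => (A y).det) x := by
  simp only [Matrix.det_apply]
  refine regAt_sum _ fun σ _ => ?_
  have : X.RegAt (fun y => ∏ i, A y (σ i) i) x := regAt_prod _ fun i _ =>
    h ((LinearMap.proj (R := ℂ) (φ := fun _ : n => ℂ) i).comp
      (LinearMap.proj (R := ℂ) (φ := fun _ : n => n → ℂ) (σ i)))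
  have h2 := X.regAt_mul (X.regAt_const ((Equiv.Perm.sign σ : ℤ) : ℂ) x) this
  refine X.regAt_congr (Eventually.of_forall fun y => ?_) h2
  simp [Units.smul_def]

theorem adjugate {n : Type} [Fintype n] [DecidableEq n] {A : X → Matrix n n ℂ}
    (h : X.RegMapAt A x) : X.RegMapAt (fun y => (A y).adjugate) x := by
  refine pi fun i => pi fun j => of_regAt ?_
  simp only [Matrix.adjugate_apply]
  refine det (pi fun k => ?_)
  by_cases hk : k = j
  · subst hk
    simpa using const _ _
  · simp only [Matrix.updateRow_ne hk]
    exact h.linear (LinearMap.proj (R := ℂ) (φ := fun _ : n => n → ℂ) k)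

theorem linearMapDet [FiniteDimensional ℂ M] {g : X → Module.End ℂ M} (h : X.RegMapAt g x) :
    X.RegAt (fun y => LinearMap.det (g y)) x := by
  let b := Module.finBasis ℂ M
  refine X.regAt_congr (Eventually.of_forall fun y => ?_)
    (h.linear (LinearMap.toMatrix b b).toLinearMap).det
  exact LinearMap.det_toMatrix b (g y)

theorem eventually_isUnit [IsLocallyRinged X] [FiniteDimensional ℂ M] {g : X → Module.End ℂ M}
    (h : X.RegMapAt g x) (hx : IsUnit (g x)) : ∀ᶠ y in 𝓝 x, IsUnit (g y) := by
  simp only [LinearMap.isUnit_iff_isUnit_det, isUnit_iff_ne_zero] at hx ⊢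
  exact IsLocallyRinged.eventually_ne h.linearMapDet hx

theorem eventually_injective [IsLocallyRinged X] [FiniteDimensional ℂ M₁] [FiniteDimensional ℂ M₂]
    {g : X → (M₁ →ₗ[ℂ] M₂)} (h : X.RegMapAt g x) (hx : Function.Injective (g x)) :
    ∀ᶠ y in 𝓝 x, Function.Injective (g y) := by
  obtain ⟨p, hp⟩ := LinearMap.exists_leftInverse_of_injective (g x) (LinearMap.ker_eq_bot.2 hx)
  have hpg : X.RegMapAt (M := Module.End ℂ M₁) (fun y => p.comp (g y)) x := linComp (const p x) h
  filter_upwards [hpg.eventually_isUnit (by rw [hp]; exact isUnit_one)] with y hy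
  exact Function.Injective.of_comp (f := p) ((Module.End.isUnit_iff _).1 hy).1

theorem eventually_surjective [IsLocallyRinged X] [FiniteDimensional ℂ M₁]
    [FiniteDimensional ℂ M₂] {g : X → (M₁ →ₗ[ℂ] M₂)} (h : X.RegMapAt g x)
    (hx : Function.Surjective (g x)) : ∀ᶠ y in 𝓝 x, Function.Surjective (g y) := by
  obtain ⟨p, hp⟩ := LinearMap.exists_rightInverse_of_surjective (g x) (LinearMap.range_eq_top.2 hx)
  have hgp : X.RegMapAt (M := Module.End ℂ M₂) (fun y => (g y).comp p) x := linComp h (const p x)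
  filter_upwards [hgp.eventually_isUnit (by rw [hp]; exact isUnit_one)] with y hy
  exact Function.Surjective.of_comp (g := p) ((Module.End.isUnit_iff _).1 hy).2

theorem ringInverse [IsLocallyRinged X] [FiniteDimensional ℂ M] {g : X → Module.End ℂ M}
    (h : X.RegMapAt g x) (hx : IsUnit (g x)) : X.RegMapAt (fun y => Ring.inverse (g y)) x := by
  let b := Module.finBasis ℂ M
  let e := LinearMap.toMatrixAlgEquiv b
  have hA : X.RegMapAt (fun y => e (g y)) x := h.linear e.toLinearMap
  have hdet : (e (g x)).det ≠ 0 := by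
    rw [← isUnit_iff_ne_zero, ← Matrix.isUnit_iff_isUnit_det]
    exact hx.map e
  refine ((smul (IsLocallyRinged.regAt_inv hA.det hdet) hA.adjugate).linear
    e.symm.toLinearMap).congr ?_
  filter_upwards [h.eventually_isUnit hx] with y hy
  obtain ⟨u, hu⟩ := hy
  have hinv : (e (g y))⁻¹ = e ↑u⁻¹ :=
    Matrix.inv_eq_right_inv (by rw [← map_mul, ← hu, Units.mul_inv, map_one])
  have hcramer : (e (g y)).det⁻¹ • (e (g y)).adjugate = e ↑u⁻¹ := by
    rw [← hinv, Matrix.inv_def, Ring.inverse_eq_inv']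
  rw [← hu] at hcramer ⊢
  rw [Ring.inverse_unit, hcramer]
  exact e.symm_apply_apply _

end RegMapAt

end RegMap

end FunctionSpace

namespace FunctionSpace

/-! ### Affine spaces -/

section AffineSpace

variable (V : Type) [AddCommGroup V] [Module ℂ V]

theorem isTopologicalBasis_affineSpace :
    TopologicalSpace.IsTopologicalBasis
      {U : Set (affineSpace V) | ∃ p : affineSpace V → ℂ, p ∈ polyFun V ∧ U = {x | p x ≠ 0}} where
  exists_subset_inter := by
    rintro _ ⟨p, hp, rfl⟩ _ ⟨q, hq, rfl⟩ x ⟨hx, hx'⟩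
    exact ⟨_, ⟨p * q, mul_mem hp hq, rfl⟩, mul_ne_zero hx hx', fun y hy =>
      ⟨left_ne_zero_of_mul hy, right_ne_zero_of_mul hy⟩⟩
  sUnion_eq := by
    refine eq_univ_of_forall fun x => mem_sUnion.2 ⟨_, ⟨1, (polyFun V).one_mem, rfl⟩, ?_⟩
    simp
  eq_generateFrom := rfl

variable {V} in
theorem exists_polyFun_of_mem_nhds {x : affineSpace V} {U : Set (affineSpace V)} (hU : U ∈ 𝓝 x) :
    ∃ p : affineSpace V → ℂ, p ∈ polyFun V ∧ p x ≠ 0 ∧ {y | p y ≠ 0} ⊆ U := by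
  obtain ⟨_, ⟨p, hp, rfl⟩, h1, h2⟩ := (isTopologicalBasis_affineSpace V).mem_nhds_iff.1 hU
  exact ⟨p, hp, h1, h2⟩

variable {V}

/-- A polynomial in the coordinates of a basis, as a function on the vector space. -/
noncomputable def evalCoord {ι : Type} (b : Module.Basis ι ℂ V) :
    MvPolynomial ι ℂ →ₐ[ℂ] (V → ℂ) :=
  MvPolynomial.aeval fun i x => b.coord i x

theorem evalCoord_apply {ι : Type} (b : Module.Basis ι ℂ V) (P : MvPolynomial ι ℂ) (x : V) :
    evalCoord b P x = MvPolynomial.eval (fun i => b.coord i x) P := by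
  have : (Pi.evalAlgHom ℂ (fun _ : V => ℂ) x).comp (evalCoord b) =
      MvPolynomial.aeval fun i => b.coord i x := by
    ext i
    simp [evalCoord]
  exact congrArg (fun g => g P) this

theorem evalCoord_injective {ι : Type} [Finite ι] (b : Module.Basis ι ℂ V) :
    Function.Injective (evalCoord b) := by
  have := Fintype.ofFinite ι
  intro P Q h
  refine MvPolynomial.funext fun c => ?_
  have h2 := congrFun h (b.equivFun.symm c)
  rw [evalCoord_apply, evalCoord_apply] at h2
  have : (fun i => b.coord i (b.equivFun.symm c)) = c := by
    funext i
    rw [b.coord_equivFun_symm]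
  rwa [this] at h2

theorem range_evalCoord {ι : Type} [Finite ι] (b : Module.Basis ι ℂ V) :
    (evalCoord b).range = polyFun V := by
  have := Fintype.ofFinite ι
  rw [evalCoord, ← Algebra.adjoin_range_eq_range_aeval]
  apply le_antisymm
  · refine Algebra.adjoin_mono ?_
    rintro _ ⟨i, rfl⟩
    exact ⟨b.coord i, rfl⟩
  · refine Algebra.adjoin_le ?_
    rintro _ ⟨φ, rfl⟩
    have : (fun x => φ x) = ∑ i, φ (b i) • (fun x => b.coord i x : V → ℂ) := by
      funext x
      conv_lhs => rw [← b.sum_repr x, map_sum]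
      simp [mul_comm]
    rw [this]
    exact sum_mem fun i _ => Subalgebra.smul_mem _ (Algebra.subset_adjoin (mem_range_self i)) _

variable (V) [FiniteDimensional ℂ V]

/-- The algebra of polynomial functions is a polynomial algebra. -/
noncomputable def polyFunEquiv :
    MvPolynomial (Fin (Module.finrank ℂ V)) ℂ ≃ₐ[ℂ] polyFun V :=
  (AlgEquiv.ofInjective _ (evalCoord_injective (Module.finBasis ℂ V))).trans
    (Subalgebra.equivOfEq _ _ (range_evalCoord _))

instance : IsDomain (polyFun V) :=
  (polyFunEquiv V).symm.toMulEquiv.isDomain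

instance : IsRegularRing (polyFun V) :=
  IsRegularRing.of_ringEquiv (polyFunEquiv V).toRingEquiv

instance : Algebra.FiniteType ℂ (polyFun V) :=
  Algebra.FiniteType.equiv inferInstance (polyFunEquiv V)

instance : IrreducibleSpace (affineSpace V) where
  isPreirreducible_univ := by
    rintro U U' hU hU' ⟨x, -, hx⟩ ⟨x', -, hx'⟩
    obtain ⟨p, hp, hpx, hpU⟩ := exists_polyFun_of_mem_nhds (hU.mem_nhds hx)
    obtain ⟨q, hq, hqx, hqU⟩ := exists_polyFun_of_mem_nhds (hU'.mem_nhds hx')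
    have : (⟨p, hp⟩ * ⟨q, hq⟩ : polyFun V) ≠ 0 := by
      refine mul_ne_zero (fun h => hpx ?_) fun h => hqx ?_
      · exact congrFun (congrArg Subtype.val h) x
      · exact congrFun (congrArg Subtype.val h) x'
    obtain ⟨y, hy⟩ : ∃ y, p y * q y ≠ 0 := by
      by_contra! h
      exact this (Subtype.ext (funext h))
    exact ⟨y, mem_univ _, hpU (left_ne_zero_of_mul hy), hqU (right_ne_zero_of_mul hy)⟩
  toNonempty := ⟨(0 : V)⟩

variable {V}

theorem polyFun_eq_of_eventuallyEq {p q : affineSpace V → ℂ} (hp : p ∈ polyFun V)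
    (hq : q ∈ polyFun V) {x : affineSpace V} (h : p =ᶠ[𝓝 x] q) : p = q := by
  by_contra hne
  obtain ⟨y, hy⟩ := Function.ne_iff.1 hne
  obtain ⟨O, hO, hOo, hxO⟩ := eventually_nhds_iff.1 h
  obtain ⟨z, hz, hz'⟩ := nonempty_preirreducible_inter hOo
    (isOpen_polyFun_ne_zero (sub_mem hp hq)) ⟨x, hxO⟩ ⟨y, sub_ne_zero.2 hy⟩
  exact hz' (sub_eq_zero.2 (hO z hz))

variable {M : Type} [AddCommGroup M] [Module ℂ M]

/-- The ideal of polynomial functions that vanish on `Z`. -/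
def vanishingIdeal (Z : Set (affineSpace M)) : Ideal (polyFun M) where
  carrier := {p | ∀ z ∈ Z, p.1 z = 0}
  zero_mem' := fun _ _ => rfl
  add_mem' {p q} hp hq z hz := by
    change p.1 z + q.1 z = 0
    rw [hp z hz, hq z hz, add_zero]
  smul_mem' c p hp z hz := by
    change c.1 z * p.1 z = 0
    rw [hp z hz, mul_zero]

theorem mem_closure_iff_vanishingIdeal {Z : Set (affineSpace M)} {x : affineSpace M} :
    x ∈ closure Z ↔ ∀ p ∈ vanishingIdeal Z, p.1 x = 0 := by
  constructor
  · intro hx p hp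
    by_contra hpx
    obtain ⟨z, hpz, hz⟩ := mem_closure_iff.1 hx _ (isOpen_polyFun_ne_zero p.2) hpx
    exact hpz (hp z hz)
  · intro h
    by_contra hx
    obtain ⟨p, hp, hpx, hpZ⟩ :=
      exists_polyFun_of_mem_nhds (isClosed_closure.isOpen_compl.mem_nhds hx)
    refine hpx (h ⟨p, hp⟩ fun z hz => ?_)
    by_contra hpz
    exact hpZ hpz (subset_closure hz)

theorem isPrime_vanishingIdeal {Z : Set (affineSpace M)} (hZ : IsIrreducible Z) :
    (vanishingIdeal Z).IsPrime where
  ne_top' h := by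
    obtain ⟨z, hz⟩ := hZ.nonempty
    have hone : (1 : polyFun M) ∈ vanishingIdeal Z := h ▸ Submodule.mem_top
    exact one_ne_zero (α := ℂ) (hone z hz)
  mem_or_mem' {p q} hpq := by
    by_contra! h
    obtain ⟨⟨z, hz, hpz⟩, ⟨z', hz', hqz'⟩⟩ :
        (∃ z ∈ Z, p.1 z ≠ 0) ∧ ∃ z ∈ Z, q.1 z ≠ 0 := by
      constructor <;> by_contra! h'
      exacts [h.1 h', h.2 h']
    obtain ⟨y, hy, hpy, hqy⟩ := hZ.isPreirreducible _ _ (isOpen_polyFun_ne_zero p.2)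
      (isOpen_polyFun_ne_zero q.2) ⟨z, hz, hpz⟩ ⟨z', hz', hqz'⟩
    exact mul_ne_zero hpy hqy (hpq y hy)

instance (x : affineSpace M) : (vanishingIdeal {x}).IsPrime :=
  isPrime_vanishingIdeal isIrreducible_singleton

end AffineSpace

/-! ### Local rings -/

section Germ

variable {X : FunctionSpace} {x : X} {M : Type} [AddCommGroup M] [Module ℂ M]

/-- The germ of a function that is regular at `x`, as an element of the local ring. -/
def germ {f : X → ℂ} (hf : X.RegAt f x) : X.stalk x :=
  ⟨(f : Germ (𝓝 x) ℂ), f, hf, rfl⟩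

theorem germ_eq_germ_iff {f g : X → ℂ} (hf : X.RegAt f x) (hg : X.RegAt g x) :
    germ hf = germ hg ↔ f =ᶠ[𝓝 x] g :=
  Subtype.ext_iff.trans Germ.coe_eq

theorem exists_germ_eq (s : X.stalk x) : ∃ (f : X → ℂ) (hf : X.RegAt f x), germ hf = s := by
  obtain ⟨_, f, hf, rfl⟩ := s
  exact ⟨f, hf, rfl⟩

instance (X : FunctionSpace) (x : X) : Algebra ℂ (X.stalk x) :=
  RingHom.toAlgebra
    { toFun c := germ (X.regAt_const c x)
      map_one' := rfl
      map_zero' := rfl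
      map_add' _ _ := rfl
      map_mul' _ _ := rfl }

/-- The pull-back of polynomial functions to germs, along a map that is regular at `x`. -/
def RegMapAt.pullback {θ : X → M} (h : X.RegMapAt θ x) : polyFun M →ₐ[ℂ] X.stalk x where
  toFun p := germ (h.comp_polyFun p.2)
  map_one' := rfl
  map_zero' := rfl
  map_add' _ _ := rfl
  map_mul' _ _ := rfl
  commutes' _ := rfl

end Germ

section Stalk

variable {X Y : FunctionSpace}

/-- The map of local rings induced by a morphism. -/
noncomputable def stalkMap {φ : X → Y} {x : X} (h : IsMorphismAt φ x) :
    Y.stalk (φ x) →ₐ[ℂ] X.stalk x where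
  toFun g := ⟨g.1.compTendsto φ h.1, by
    obtain ⟨f, hf, hg⟩ := g.2
    exact ⟨f ∘ φ, h.2 f hf, by rw [hg]; rfl⟩⟩
  map_one' := rfl
  map_zero' := rfl
  map_add' := by
    rintro ⟨_, f, hf, rfl⟩ ⟨_, g, hg, rfl⟩
    rfl
  map_mul' := by
    rintro ⟨_, f, hf, rfl⟩ ⟨_, g, hg, rfl⟩
    rfl
  commutes' _ := rfl

theorem stalkMap_bijective {φ : X → Y} {x : X} (h : IsMorphismAt φ x) {χ : Y → X}
    (h' : IsMorphismAt χ (φ x)) (hχφ : ∀ᶠ z in 𝓝 x, χ (φ z) = z)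
    (hφχ : ∀ᶠ y in 𝓝 (φ x), φ (χ y) = y) : Function.Bijective (stalkMap h) := by
  have hx : χ (φ x) = x := hχφ.self_of_nhds
  constructor
  · intro s t hst
    obtain ⟨f, hf, rfl⟩ := exists_germ_eq s
    obtain ⟨g, hg, rfl⟩ := exists_germ_eq t
    have hfg : f ∘ φ =ᶠ[𝓝 x] g ∘ φ := (germ_eq_germ_iff (h.2 f hf) (h.2 g hg)).1 hst
    have hχ : Tendsto χ (𝓝 (φ x)) (𝓝 x) := by
      have hcont := h'.1
      rwa [ContinuousAt, hx] at hcont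
    refine (germ_eq_germ_iff hf hg).2 ?_
    filter_upwards [hχ.eventually hfg, hφχ] with y hy hφy
    simpa [hφy] using hy
  · intro s
    obtain ⟨f, hf, rfl⟩ := exists_germ_eq s
    have hfχ : Y.RegAt (f ∘ χ) (φ x) := h'.2 f (by rwa [hx])
    refine ⟨germ hfχ, (germ_eq_germ_iff (h.2 _ hfχ) hf).2 ?_⟩
    filter_upwards [hχφ] with z hz
    simp [hz]

end Stalk

section AffineStalk

variable {V : Type} [AddCommGroup V] [Module ℂ V]

noncomputable instance (x : affineSpace V) : Algebra (polyFun V) ((affineSpace V).stalk x) :=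
  (regMapAt_id (M := V) x).pullback.toAlgebra

instance (x : affineSpace V) : IsScalarTower ℂ (polyFun V) ((affineSpace V).stalk x) :=
  .of_algebraMap_eq' rfl

variable [FiniteDimensional ℂ V]

instance (x : affineSpace V) :
    IsLocalization.AtPrime ((affineSpace V).stalk x) (vanishingIdeal {x}) := by
  have hreg {p : affineSpace V → ℂ} (hp : p ∈ polyFun V) : (affineSpace V).RegAt p x :=
    (regMapAt_id (M := V) x).comp_polyFun hp
  refine ⟨?_, ?_, ?_⟩
  · rintro ⟨p, hp⟩
    have hpx : p.1 x ≠ 0 := fun h => hp fun _ hz => hz ▸ h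
    have hinv := IsLocallyRinged.regAt_inv (hreg p.2) hpx
    refine IsUnit.of_mul_eq_one (germ hinv) ((germ_eq_germ_iff
      ((affineSpace V).regAt_mul (hreg p.2) hinv) ((affineSpace V).regAt_const 1 x)).2 ?_)
    filter_upwards [IsLocallyRinged.eventually_ne (hreg p.2) hpx] with y hy
    exact mul_inv_cancel₀ hy
  · intro s
    obtain ⟨f, hf, rfl⟩ := exists_germ_eq s
    obtain ⟨p, hp, q, hq, hqx, h⟩ := regAt_affineSpace_iff.1 hf
    refine ⟨(⟨p, hp⟩, ⟨⟨q, hq⟩, fun h => hqx (h x rfl)⟩),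
      (germ_eq_germ_iff ((affineSpace V).regAt_mul hf (hreg hq)) (hreg hp)).2 ?_⟩
    filter_upwards [h, IsLocallyRinged.eventually_ne (hreg hq) hqx] with y hfy hqy
    rw [Pi.mul_apply, hfy, div_mul_cancel₀ _ hqy]
  · intro p q h
    have hpq : p = q := Subtype.ext (polyFun_eq_of_eventuallyEq p.2 q.2
      ((germ_eq_germ_iff (hreg p.2) (hreg q.2)).1 h))
    exact ⟨1, by rw [hpq]⟩

theorem isRegularLocalRing_of_isLocalization_atPrime {R A : Type*} [CommRing R] [IsRegularRing R]
    [CommRing A] [Algebra R A] (p : Ideal R) [p.IsPrime] [IsLocalization.AtPrime A p] :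
    IsRegularLocalRing A :=
  IsRegularLocalRing.of_ringEquiv
    (IsLocalization.algEquiv p.primeCompl (Localization.AtPrime p) A).toRingEquiv

instance (x : affineSpace V) : IsRegularLocalRing ((affineSpace V).stalk x) :=
  isRegularLocalRing_of_isLocalization_atPrime (vanishingIdeal {x})

instance (x : affineSpace V) : IsDomain ((affineSpace V).stalk x) :=
  IsLocalization.isDomain_of_le_nonZeroDivisors _ (M := (vanishingIdeal {x}).primeCompl)
    (vanishingIdeal {x}).primeCompl_le_nonZeroDivisors

theorem trdeg_polyFun : Algebra.trdeg ℂ (polyFun V) = Module.finrank ℂ V := by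
  rw [← (polyFunEquiv V).trdeg_eq, MvPolynomial.trdeg_of_isDomain]
  simp

theorem trdeg_affineSpace_stalk (x : affineSpace V) :
    Algebra.trdeg ℂ ((affineSpace V).stalk x) = Module.finrank ℂ V := by
  have hinj : Function.Injective (algebraMap (polyFun V) ((affineSpace V).stalk x)) :=
    IsLocalization.injective _ (vanishingIdeal {x}).primeCompl_le_nonZeroDivisors
  have := (faithfulSMul_iff_algebraMap_injective _ _).2 hinj
  have := (faithfulSMul_iff_algebraMap_injective ℂ (polyFun V)).2
    (algebraMap ℂ (polyFun V)).injective
  have := IsLocalization.isAlgebraic (S := (affineSpace V).stalk x)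
    (vanishingIdeal {x}).primeCompl
  rw [← trdeg_add_eq ℂ (polyFun V),
    trdeg_eq_zero (A := (affineSpace V).stalk x), add_zero, trdeg_polyFun]

end AffineStalk

/-! ### Dimension -/

theorem ringKrullDim_le_of_trdeg_le {k R : Type*} [Field k] [CommRing R] [Nontrivial R]
    [Algebra k R] [Algebra.FiniteType k R] {n : ℕ} (hn : Algebra.trdeg k R ≤ n) :
    ringKrullDim R ≤ n := by
  obtain ⟨s, g, hinj, hint⟩ := exists_integral_inj_algHom_of_fg k R
  have hsn : s ≤ n := by
    have hle := lift_trdeg_le_of_injective g hinj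
    rw [MvPolynomial.trdeg_of_isDomain] at hle
    have := hle.trans (Cardinal.lift_le.2 hn)
    simpa using this
  let _ : Algebra (MvPolynomial (Fin s) k) R := g.toRingHom.toAlgebra
  have : Algebra.IsIntegral (MvPolynomial (Fin s) k) R := ⟨hint⟩
  have hdim : ringKrullDim R ≤ ringKrullDim (MvPolynomial (Fin s) k) :=
    Order.krullDim_le_of_strictMono
      (PrimeSpectrum.comap (algebraMap (MvPolynomial (Fin s) k) R)) fun p q hpq =>
        Ideal.IsIntegral.comap_lt_comap (I := p.asIdeal) (J := q.asIdeal) hpq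
  rw [MvPolynomial.ringKrullDim_of_isNoetherianRing, ringKrullDim_eq_zero_of_field] at hdim
  exact hdim.trans (by simpa using hsn)

section UpperBound

variable {M : Type} [AddCommGroup M] [Module ℂ M]

theorem topologicalKrullDim_le_ringKrullDim_quotient {S : Set (affineSpace M)}
    {I : Ideal (polyFun M)} (hI : I ≤ vanishingIdeal S) :
    topologicalKrullDim S ≤ ringKrullDim (polyFun M ⧸ I) := by
  let ideal (Z : TopologicalSpace.IrreducibleCloseds S) : PrimeSpectrum.zeroLocus (I : Set _) :=
    ⟨⟨vanishingIdeal (Subtype.val '' (Z : Set S)), isPrime_vanishingIdeal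
      (Z.isIrreducible.image _ continuous_subtype_val.continuousOn)⟩, by
      rintro p hp _ ⟨z, -, rfl⟩
      exact hI hp z.1 z.2⟩
  have hle {Z Z' : TopologicalSpace.IrreducibleCloseds S}
      (h : (ideal Z').1.asIdeal ≤ (ideal Z).1.asIdeal) : Z ≤ Z' := by
    intro z hz
    change z ∈ (Z' : Set S)
    rw [← Z'.isClosed.closure_eq, closure_subtype, mem_closure_iff_vanishingIdeal]
    exact fun p hp => h hp z.1 (mem_image_of_mem _ hz)
  have hmono : StrictMono fun Z : (TopologicalSpace.IrreducibleCloseds S)ᵒᵈ =>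
      ideal (OrderDual.ofDual Z) := by
    refine fun Z Z' hZ => lt_of_le_not_ge (fun p hp => ?_) fun h => hZ.not_ge (hle h)
    exact fun z hz => hp z (image_mono hZ.le hz)
  rw [ringKrullDim_quotient, topologicalKrullDim, ← Order.krullDim_orderDual]
  exact Order.krullDim_le_of_strictMono _ hmono

theorem topologicalKrullDim_le_of_subset_closure_range [FiniteDimensional ℂ M]
    {X : FunctionSpace} [IrreducibleSpace X] {θ : X → affineSpace M} (hθ : IsMorphism θ)
    {S : Set (affineSpace M)} (hS : S ⊆ closure (range θ)) {x : X} [Nontrivial (X.stalk x)] {n : ℕ}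
    (hn : Algebra.trdeg ℂ (X.stalk x) ≤ n) : topologicalKrullDim S ≤ n := by
  have hreg : X.RegMapAt (M := M) θ x :=
    (isMorphism_iff.1 hθ x).regMapAt (regMapAt_id (M := M) _)
  let f : polyFun M →ₐ[ℂ] X.stalk x := hreg.pullback
  have hker : RingHom.ker f ≤ vanishingIdeal S := by
    intro p hp z hz
    have hzero : ∀ᶠ y in 𝓝 x, p.1 (θ y) = 0 :=
      (germ_eq_germ_iff (hreg.comp_polyFun p.2) (X.regAt_const 0 x)).1 hp
    refine mem_closure_iff_vanishingIdeal.1 (hS hz) p ?_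
    rintro _ ⟨y, rfl⟩
    by_contra hy
    obtain ⟨O, hO, hOo, hxO⟩ := eventually_nhds_iff.1 hzero
    obtain ⟨t, htO, ht⟩ := nonempty_preirreducible_inter hOo
      ((isOpen_polyFun_ne_zero p.2).preimage hθ.1) ⟨x, hxO⟩ ⟨y, hy⟩
    exact ht (hO t htO)
  have := Ideal.Quotient.nontrivial_iff.2 (RingHom.ker_ne_top f)
  have htrdeg : Algebra.trdeg ℂ (polyFun M ⧸ RingHom.ker f) ≤ n :=
    (trdeg_le_of_injective _ (Ideal.kerLiftAlg_injective f)).trans hn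
  exact (topologicalKrullDim_le_ringKrullDim_quotient hker).trans
    (ringKrullDim_le_of_trdeg_le htrdeg)

end UpperBound

section LowerBound

variable {V : Type} [AddCommGroup V] [Module ℂ V] [FiniteDimensional ℂ V]

theorem isIrreducible_mk' (u : V) (W : Submodule ℂ V) :
    IsIrreducible (X := affineSpace V) (AffineSubspace.mk' u W : Set V) := by
  let translate (z : affineSpace W) : affineSpace V := (W.subtype z + u : V)
  have hcont : Continuous translate := continuous_iff_continuousAt.2 fun z =>
    (((regMapAt_id (M := W) z).linear W.subtype).add (.const u z)).isMorphismAt.1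
  have hrange : (AffineSubspace.mk' u W : Set V) = translate '' univ := by
    ext y
    exact ⟨fun hy => ⟨⟨y - u, hy⟩, mem_univ _, sub_add_cancel y u⟩, by
      rintro ⟨z, -, rfl⟩
      exact AffineSubspace.vadd_mem_mk' u z.2⟩
  rw [hrange]
  exact (IrreducibleSpace.isIrreducible_univ (affineSpace W)).image _ hcont.continuousOn

omit [FiniteDimensional ℂ V] in
theorem isClosed_mk' (u : V) (W : Submodule ℂ V) :
    IsClosed (X := affineSpace V) (AffineSubspace.mk' u W : Set V) := by
  refine closure_subset_iff_isClosed.1 fun y hy => ?_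
  by_contra hyW
  obtain ⟨φ, hφ, hW⟩ := Submodule.exists_le_ker_of_notMem
    (fun h => hyW ((AffineSubspace.mem_mk' (p := u) (q := (y : V))).2 h))
  have hp : (fun y : V => φ y) - algebraMap ℂ (V → ℂ) (φ u) ∈ polyFun V :=
    sub_mem (Algebra.subset_adjoin ⟨φ, rfl⟩) (Subalgebra.algebraMap_mem _ _)
  have hvanish (z : V) : ((fun y : V => φ y) - algebraMap ℂ (V → ℂ) (φ u)) z = φ (z -ᵥ u) := by
    simp
  refine hφ ((hvanish y).symm.trans (mem_closure_iff_vanishingIdeal.1 hy ⟨_, hp⟩ ?_))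
  exact fun z hz => (hvanish z).trans (hW ((AffineSubspace.mem_mk' (p := u) (q := (z : V))).1 hz))

theorem finrank_le_topologicalKrullDim {U : Set (affineSpace V)}
    (hU : IsOpen U) (hne : U.Nonempty) :
    (Module.finrank ℂ V : WithBot ℕ∞) ≤ topologicalKrullDim U := by
  obtain ⟨(u : V), hu⟩ := hne
  let Z (W : Submodule ℂ V) : TopologicalSpace.IrreducibleCloseds (affineSpace V) :=
    ⟨(AffineSubspace.mk' u W : Set V), isIrreducible_mk' u W, isClosed_mk' u W⟩
  have hZ : StrictMono Z := fun W W' hW => by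
    have hle : Z W ≤ Z W' := fun y hy => hW.le hy
    refine lt_of_le_not_ge hle fun h => hW.not_ge fun z hz => ?_
    have hmem : (z +ᵥ u : V) ∈ AffineSubspace.mk' u W :=
      h (AffineSubspace.vadd_mem_mk' u hz)
    simpa using hmem
  let F (W : Submodule ℂ V) : TopologicalSpace.IrreducibleCloseds U :=
    (TopologicalSpace.IrreducibleCloseds.orderIsoOfIsOpenEmbedding _
      hU.isOpenEmbedding_subtypeVal).symm
      ⟨Z W, ⟨⟨u, hu⟩, AffineSubspace.self_mem_mk' u W⟩⟩
  have hF : StrictMono F := fun W W' hW => (OrderIso.strictMono _) (hZ hW)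
  have hlength := Order.krullDim_le_of_strictMono F hF
  rw [← Module.coe_length, Module.length_eq_finrank] at hlength
  exact_mod_cast hlength

theorem topologicalKrullDim_affineSpace :
    topologicalKrullDim (affineSpace V) = Module.finrank ℂ V := by
  rw [← IsHomeomorph.topologicalKrullDim_eq _ (Homeomorph.Set.univ (affineSpace V)).isHomeomorph]
  refine le_antisymm ?_ (finrank_le_topologicalKrullDim isOpen_univ univ_nonempty)
  refine topologicalKrullDim_le_of_subset_closure_range (X := affineSpace V) (θ := id)
    ⟨continuous_id, fun _ _ hf => hf⟩ ?_ (trdeg_affineSpace_stalk (0 : V)).le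
  rw [range_id, closure_univ]

end LowerBound

end FunctionSpace

namespace FunctionSpace

/-! ### Charts -/

/-- An isomorphism of an affine space with an open subset. -/
structure AffineChart (X : FunctionSpace) (T : Type) [AddCommGroup T] [Module ℂ T] where
  toFun : affineSpace T → X
  invFun : X → affineSpace T
  target : Set X
  isOpen_target : IsOpen target
  mapsTo : ∀ t, toFun t ∈ target
  left_inv : ∀ t, invFun (toFun t) = t
  right_inv : ∀ x ∈ target, toFun (invFun x) = x
  isMorphismAt_toFun : ∀ t, IsMorphismAt toFun t
  isMorphismAt_invFun : ∀ x ∈ target, IsMorphismAt invFun x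

namespace AffineChart

variable {X : FunctionSpace} {T : Type} [AddCommGroup T] [Module ℂ T]

theorem isOpenEmbedding (c : AffineChart X T) : IsOpenEmbedding c.toFun := by
  refine .of_continuous_injective_isOpenMap
    (continuous_iff_continuousAt.2 fun t => (c.isMorphismAt_toFun t).1)
    (Function.LeftInverse.injective c.left_inv) fun N hN => ?_
  have : c.toFun '' N = c.target ∩ c.invFun ⁻¹' N := by
    ext x
    constructor
    · rintro ⟨t, ht, rfl⟩
      exact ⟨c.mapsTo t, by simpa [c.left_inv] using ht⟩
    · rintro ⟨hx, hxN⟩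
      exact ⟨_, hxN, c.right_inv x hx⟩
  rw [this]
  exact ContinuousOn.isOpen_inter_preimage
    (fun x hx => (c.isMorphismAt_invFun x hx).1.continuousWithinAt) c.isOpen_target hN

/-- The local ring of `X` in a chart. -/
noncomputable def stalkEquiv (c : AffineChart X T) (t : affineSpace T) :
    X.stalk (c.toFun t) ≃ₐ[ℂ] (affineSpace T).stalk t :=
  AlgEquiv.ofBijective (stalkMap (c.isMorphismAt_toFun t))
    (stalkMap_bijective _ (c.isMorphismAt_invFun _ (c.mapsTo t))
      (Eventually.of_forall c.left_inv)
      (eventually_of_mem (c.isOpen_target.mem_nhds (c.mapsTo t)) c.right_inv))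

/-- Transport of a chart along an isomorphism of varieties. -/
def ofIso {Y : FunctionSpace} (c : AffineChart X T) {φ : X → Y} {ψ : Y → X}
    (hψφ : ∀ x, ψ (φ x) = x) (hφψ : ∀ y, φ (ψ y) = y) (hφ : ∀ x, IsMorphismAt φ x)
    (hψ : ∀ y, IsMorphismAt ψ y) : AffineChart Y T where
  toFun t := φ (c.toFun t)
  invFun y := c.invFun (ψ y)
  target := ψ ⁻¹' c.target
  isOpen_target := c.isOpen_target.preimage (isMorphism_iff.2 hψ).1
  mapsTo t := by simpa [hψφ] using c.mapsTo t
  left_inv t := by simp [hψφ, c.left_inv]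
  right_inv y hy := by rw [c.right_inv _ hy, hφψ]
  isMorphismAt_toFun t := (hφ _).comp (c.isMorphismAt_toFun t)
  isMorphismAt_invFun y hy := (c.isMorphismAt_invFun _ hy).comp (hψ y)

/-- Transport of a chart along a linear isomorphism of its model. -/
def ofLinearEquiv (c : AffineChart X T) {T' : Type} [AddCommGroup T'] [Module ℂ T']
    (e : T' ≃ₗ[ℂ] T) : AffineChart X T' where
  toFun t := c.toFun (e t)
  invFun x := e.symm (c.invFun x)
  target := c.target
  isOpen_target := c.isOpen_target
  mapsTo _ := c.mapsTo _
  left_inv t := (congrArg e.symm (c.left_inv _)).trans (e.symm_apply_apply t)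
  right_inv x hx := (congrArg c.toFun (e.apply_symm_apply _)).trans (c.right_inv x hx)
  isMorphismAt_toFun t := (c.isMorphismAt_toFun _).comp
    ((regMapAt_id (M := T') t).linear e.toLinearMap).isMorphismAt
  isMorphismAt_invFun x hx := IsMorphismAt.comp
    (Y := affineSpace T) (Z := affineSpace T') (ψ := e.symm)
    ((regMapAt_id (M := T) _).linear e.symm.toLinearMap).isMorphismAt (c.isMorphismAt_invFun x hx)

/-- Replacement of the model of a chart by `ℂ ^ n`. -/
noncomputable def ofFinrankEq [FiniteDimensional ℂ T] (c : AffineChart X T) {n : ℕ}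
    (h : Module.finrank ℂ T = n) : AffineChart X (Fin n → ℂ) :=
  c.ofLinearEquiv (LinearEquiv.ofFinrankEq _ _ ((Module.finrank_fin_fun ℂ).trans h.symm))

end AffineChart

/-- `X` is covered by open subsets isomorphic to the affine space of dimension `n`. -/
def IsLocallyAffineSpace (X : FunctionSpace) (n : ℕ) : Prop :=
  ∀ x : X, ∃ c : AffineChart X (Fin n → ℂ), x ∈ c.target

namespace IsLocallyAffineSpace

variable {X : FunctionSpace} {n : ℕ}

theorem exists_stalkEquiv (hX : X.IsLocallyAffineSpace n) (x : X) :
    ∃ t : affineSpace (Fin n → ℂ),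
      Nonempty (X.stalk x ≃ₐ[ℂ] (affineSpace (Fin n → ℂ)).stalk t) := by
  obtain ⟨c, hx⟩ := hX x
  rw [← c.right_inv x hx]
  exact ⟨_, ⟨c.stalkEquiv _⟩⟩

theorem isNonsingular (hX : X.IsLocallyAffineSpace n) : X.IsNonsingular := by
  intro x
  obtain ⟨t, ⟨e⟩⟩ := hX.exists_stalkEquiv x
  exact IsRegularLocalRing.of_ringEquiv e.symm.toRingEquiv

theorem trdeg_stalk (hX : X.IsLocallyAffineSpace n) (x : X) :
    Algebra.trdeg ℂ (X.stalk x) = n := by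
  obtain ⟨t, ⟨e⟩⟩ := hX.exists_stalkEquiv x
  rw [e.trdeg_eq, trdeg_affineSpace_stalk, Module.finrank_fin_fun]

theorem le_topologicalKrullDim_of_isOpen (hX : X.IsLocallyAffineSpace n) {U : Set X}
    (hU : IsOpen U) (hne : U.Nonempty) : n ≤ topologicalKrullDim U := by
  obtain ⟨x, hx⟩ := hne
  obtain ⟨c, hxc⟩ := hX x
  have hdim := finrank_le_topologicalKrullDim (hU.preimage c.isOpenEmbedding.continuous)
    ⟨c.invFun x, by rwa [mem_preimage, c.right_inv x hxc]⟩
  rw [Module.finrank_fin_fun] at hdim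
  exact hdim.trans (c.isOpenEmbedding.isInducing.restrictPreimage U).topologicalKrullDim_le

theorem hasDim [Nonempty X] (hX : X.IsLocallyAffineSpace n) : X.HasDim n := by
  refine ⟨n, le_antisymm ?_ ?_, rfl⟩
  · rw [topologicalKrullDim, Order.krullDim_eq_iSup_coheight]
    refine iSup_le fun Z => ?_
    obtain ⟨x, hx⟩ := Z.isIrreducible.nonempty
    obtain ⟨c, hxc⟩ := hX x
    let e := TopologicalSpace.IrreducibleCloseds.orderIsoOfIsOpenEmbedding _ c.isOpenEmbedding
    let Z' := e.symm ⟨Z, ⟨c.invFun x, by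
        change c.toFun (c.invFun x) ∈ (Z : Set X)
        rwa [c.right_inv x hxc]⟩⟩
    have hZ : TopologicalSpace.IrreducibleCloseds.map _ c.isOpenEmbedding.continuous Z' = Z :=
      congrArg Subtype.val (e.apply_symm_apply _)
    have hdim := topologicalKrullDim_affineSpace (V := Fin n → ℂ)
    rw [Module.finrank_fin_fun] at hdim
    rw [← hZ, c.isOpenEmbedding.coheight_map, ← hdim]
    exact Order.coheight_le_krullDim Z'
  · exact (hX.le_topologicalKrullDim_of_isOpen isOpen_univ univ_nonempty).trans
      IsInducing.subtypeVal.topologicalKrullDim_le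

/-- The upper bound for the dimension is the transcendence degree of the function field; the lower
bound comes from an open subset common to both varieties. -/
theorem hasDim_of_isBirational [IrreducibleSpace X] (hX : X.IsLocallyAffineSpace n)
    {M : Type} [AddCommGroup M] [Module ℂ M] [FiniteDimensional ℂ M] {S : Set (affineSpace M)}
    {φ : X → (affineSpace M).sub S} (hφ : IsBirational φ) : ((affineSpace M).sub S).HasDim n := by
  obtain ⟨hφmor, U, V, hUV, hU, hUd, -, hVd, ψ, hψφ, hφψ, hrestrict, hψ⟩ := hφ
  refine ⟨n, le_antisymm ?_ ?_, rfl⟩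
  · have hmor : IsMorphism (fun x => (φ x).1) := isMorphism_iff.2 fun x =>
      (IsMorphismAt.subVal S _).comp (isMorphism_iff.1 hφmor x)
    have hdense : DenseRange φ :=
      hVd.mono fun y hy => ⟨(ψ ⟨y, hy⟩).1, congrArg Subtype.val (hφψ ⟨y, hy⟩)⟩
    have hS : S ⊆ closure (range fun x => (φ x).1) := fun s hs => by
      rw [range_comp' Subtype.val φ]
      exact closure_subtype.1 (hdense ⟨s, hs⟩)
    obtain ⟨x⟩ := (inferInstance : Nonempty X)
    obtain ⟨t, ⟨e⟩⟩ := hX.exists_stalkEquiv x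
    have := e.toEquiv.nontrivial
    exact topologicalKrullDim_le_of_subset_closure_range hmor hS (hX.trdeg_stalk x).le
  · have hembedding := Function.LeftInverse.isEmbedding hψφ hψ.1 hrestrict.1
    exact (hX.le_topologicalKrullDim_of_isOpen hU hUd.nonempty).trans
      (hembedding.isInducing.topologicalKrullDim_le.trans
        IsInducing.subtypeVal.topologicalKrullDim_le)

end IsLocallyAffineSpace

end FunctionSpace

/-! ### Frames of subspaces -/

section NormalFrame

variable {𝕜 F K : Type*} [Field 𝕜] [AddCommGroup F] [Module 𝕜 F] [AddCommGroup K] [Module 𝕜 K]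
  {g : F →ₗ[𝕜] K} {f f' : K →ₗ[𝕜] F}

theorem isUnit_comp_iff_disjoint [FiniteDimensional 𝕜 K] (hf : Function.Injective f) :
    IsUnit (g ∘ₗ f : Module.End 𝕜 K) ↔ Disjoint (LinearMap.range f) (LinearMap.ker g) := by
  rw [LinearMap.isUnit_iff_ker_eq_bot, LinearMap.ker_eq_bot', LinearMap.disjoint_ker]
  constructor
  · rintro h _ ⟨z, rfl⟩ hz
    rw [h z hz, map_zero]
  · intro h z hz
    exact hf (by rw [h _ ⟨z, rfl⟩ hz, map_zero])

/-- The frame with the same span as `f` that is a section of `g`.  It is `0` if the span of `f`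
is not a complement of the kernel of `g`. -/
noncomputable def normalFrame (g : F →ₗ[𝕜] K) (f : K →ₗ[𝕜] F) : K →ₗ[𝕜] F :=
  f ∘ₗ Ring.inverse (g ∘ₗ f : Module.End 𝕜 K)

theorem comp_normalFrame (h : IsUnit (g ∘ₗ f : Module.End 𝕜 K)) :
    g ∘ₗ normalFrame g f = LinearMap.id :=
  Ring.mul_inverse_cancel (g ∘ₗ f : Module.End 𝕜 K) h

theorem normalFrame_eq_self (h : g ∘ₗ f = LinearMap.id) : normalFrame g f = f := by
  rw [normalFrame, h]
  exact congrArg (f ∘ₗ ·) (Ring.inverse_one (Module.End 𝕜 K))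

theorem range_normalFrame (h : IsUnit (g ∘ₗ f : Module.End 𝕜 K)) :
    LinearMap.range (normalFrame g f) = LinearMap.range f :=
  LinearMap.range_comp_of_range_eq_top _
    (LinearMap.range_eq_top.2 ((Module.End.isUnit_iff _).1 h.ringInverse).2)

theorem normalFrame_congr [FiniteDimensional 𝕜 K] (hf : Function.Injective f)
    (hf' : Function.Injective f') (h : LinearMap.range f = LinearMap.range f') :
    normalFrame g f = normalFrame g f' := by
  have hiff : IsUnit (g ∘ₗ f : Module.End 𝕜 K) ↔ IsUnit (g ∘ₗ f' : Module.End 𝕜 K) := by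
    rw [isUnit_comp_iff_disjoint hf, isUnit_comp_iff_disjoint hf', h]
  by_cases hg : IsUnit (g ∘ₗ f : Module.End 𝕜 K)
  · have hinj : InjOn g (LinearMap.range f) :=
      LinearMap.injOn_of_disjoint_ker subset_rfl ((isUnit_comp_iff_disjoint hf).1 hg)
    ext z
    refine hinj ⟨_, rfl⟩ (h ▸ ⟨_, rfl⟩) ?_
    exact LinearMap.congr_fun ((comp_normalFrame hg).trans (comp_normalFrame (hiff.1 hg)).symm) z
  · rw [normalFrame, normalFrame, Ring.inverse_non_unit _ hg,
      Ring.inverse_non_unit _ (hiff.not.1 hg), LinearMap.comp_zero, LinearMap.comp_zero]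

theorem comp_comp_eq_of_range_le {M : Type*} [AddCommGroup M] [Module 𝕜 M] {r : M →ₗ[𝕜] F}
    (h : g ∘ₗ f = LinearMap.id) (hr : LinearMap.range r ≤ LinearMap.range f) :
    f ∘ₗ g ∘ₗ r = r := by
  ext z
  obtain ⟨y, hy⟩ := hr ⟨z, rfl⟩
  have hgf : g (f y) = y := LinearMap.congr_fun h y
  rw [LinearMap.comp_apply, LinearMap.comp_apply, ← hy, hgf]

/-- The projection to the kernel of `g` along the image of a section of `g`. -/
def kerProj (g : F →ₗ[𝕜] K) (f : K →ₗ[𝕜] F) (h : g ∘ₗ f = LinearMap.id) :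
    F →ₗ[𝕜] LinearMap.ker g :=
  LinearMap.codRestrict _ (LinearMap.id - f ∘ₗ g) fun x => by
    have hgf : g (f (g x)) = g x := LinearMap.congr_fun h (g x)
    simp [hgf]

theorem comp_add_subtype_ker (h : g ∘ₗ f = LinearMap.id) (k : K →ₗ[𝕜] LinearMap.ker g) :
    g ∘ₗ (f + (LinearMap.ker g).subtype ∘ₗ k) = LinearMap.id := by
  rw [LinearMap.comp_add, h, ← LinearMap.comp_assoc, LinearMap.comp_ker_subtype,
    LinearMap.zero_comp, add_zero]

theorem kerProj_comp_add (h : g ∘ₗ f = LinearMap.id) (k : K →ₗ[𝕜] LinearMap.ker g) :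
    kerProj g f h ∘ₗ (f + (LinearMap.ker g).subtype ∘ₗ k) = k := by
  ext z
  have hgf : g (f z) = z := LinearMap.congr_fun h z
  simp [kerProj, hgf]

theorem add_subtype_comp_kerProj (h : g ∘ₗ f = LinearMap.id) (h' : g ∘ₗ f' = LinearMap.id) :
    f + (LinearMap.ker g).subtype ∘ₗ kerProj g f h ∘ₗ f' = f' := by
  ext z
  have hgf : g (f' z) = z := LinearMap.congr_fun h' z
  simp [kerProj, hgf]

theorem finrank_ker_add_of_comp_eq_id [FiniteDimensional 𝕜 F] (h : g ∘ₗ f = LinearMap.id) :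
    Module.finrank 𝕜 (LinearMap.ker g) + Module.finrank 𝕜 K = Module.finrank 𝕜 F := by
  have hg : LinearMap.range g = ⊤ :=
    LinearMap.range_eq_top.2 (Function.RightInverse.surjective (g := f) (LinearMap.congr_fun h))
  rw [← LinearMap.finrank_range_add_finrank_ker g, hg, finrank_top, add_comm]

end NormalFrame

theorem FunctionSpace.RegMapAt.normalFrame {X : FunctionSpace} [X.IsLocallyRinged] {x : X}
    {F K : Type} [AddCommGroup F] [Module ℂ F] [FiniteDimensional ℂ F] [AddCommGroup K]
    [Module ℂ K] [FiniteDimensional ℂ K] (g : F →ₗ[ℂ] K) {f : X → (K →ₗ[ℂ] F)}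
    (hf : X.RegMapAt f x) (h : IsUnit (g ∘ₗ f x : Module.End ℂ K)) :
    X.RegMapAt (fun y => normalFrame g (f y)) x :=
  hf.linComp (RegMapAt.ringInverse (RegMapAt.linComp (.const g x) hf) h)

section Frames

variable {ι : Type} {E : ι → Type} [∀ i, AddCommGroup (E i)] [∀ i, Module ℂ (E i)] {d : ι → ℕ}

theorem FrameMaps.exists_span_eq [∀ i, FiniteDimensional ℂ (E i)] (X : GrPoint E d) :
    ∃ (a : FrameMaps E d) (ha : ∀ i, Function.Injective (a i)), a.span ha = X := by
  let b := fun i => Module.finBasisOfFinrankEq ℂ (X.1 i) (X.2 i)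
  refine ⟨fun i => (X.1 i).subtype ∘ₗ (b i).equivFun.symm.toLinearMap, fun i => ?_,
    Subtype.ext (funext fun i => ?_)⟩
  · exact Subtype.val_injective.comp (b i).equivFun.symm.injective
  · change LinearMap.range ((X.1 i).subtype ∘ₗ _) = X.1 i
    rw [LinearMap.range_comp, LinearEquiv.range, Submodule.map_top, Submodule.range_subtype]

namespace FunctionSpace

variable {V : Type} [AddCommGroup V] [Module ℂ V]

/-- The point of `V × ∏ i, Gr(d i, E i)` given by a vector and a family of frames. -/
def frameMk (z : V × FrameMaps E d) (hz : ∀ i, Function.Injective (z.2 i)) :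
    affineProdGrassmannians E d V :=
  (z.1, FrameMaps.span z.2 hz)

theorem exists_frameMk_eq [∀ i, FiniteDimensional ℂ (E i)] (y : affineProdGrassmannians E d V) :
    ∃ (z : V × FrameMaps E d) (hz : ∀ i, Function.Injective (z.2 i)), frameMk z hz = y := by
  obtain ⟨r, X⟩ := y
  obtain ⟨a, ha, rfl⟩ := FrameMaps.exists_span_eq X
  exact ⟨(r, a), ha, rfl⟩

theorem isMorphismAt_of_frame_lift {X : FunctionSpace} [IsLocallyRinged X]
    {φ : X → affineProdGrassmannians E d V} {x : X} {Ψ : X → V × FrameMaps E d}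
    (hΨ : X.RegMapAt Ψ x)
    (h : ∀ᶠ y in 𝓝 x, ∃ hy : ∀ i, Function.Injective ((Ψ y).2 i), frameMk (Ψ y) hy = φ y) :
    IsMorphismAt φ x := by
  classical
  let L : Set (affineSpace (V × FrameMaps E d)) :=
    {z : V × FrameMaps E d | ∀ i, Function.Injective (z.2 i)}
  have hx : ∀ i, Function.Injective ((Ψ x).2 i) := h.self_of_nhds.1
  let Ψ' : X → (affineSpace (V × FrameMaps E d)).sub L := fun y =>
    if hy : ∀ i, Function.Injective ((Ψ y).2 i) then ⟨Ψ y, hy⟩ else ⟨Ψ x, hx⟩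
  have hΨ' : X.RegMapAt (M := V × FrameMaps E d) (fun y => (Ψ' y).1) x := by
    refine hΨ.congr ?_
    filter_upwards [h] with y hy
    have : Ψ' y = ⟨Ψ y, hy.1⟩ := dif_pos hy.1
    rw [this]
  have hmk := (IsMorphismAt.toQuot (X := (affineSpace (V × FrameMaps E d)).sub L)
    (Q := V × GrPoint E d)
    (fun z => (z.1.1, FrameMaps.span (E := E) (d := d) z.1.2 z.2)) (Ψ' x)).comp
      (IsMorphismAt.codRestrict hΨ'.isMorphismAt)
  refine hmk.congr ?_
  filter_upwards [h] with y ⟨hy, hy'⟩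
  have : Ψ' y = ⟨Ψ y, hy⟩ := dif_pos hy
  rw [this, ← hy']
  rfl

theorem isOpen_of_frames {O : Set (affineProdGrassmannians E d V)}
    (h : ∀ (z : affineSpace (V × FrameMaps E d)) (hz : ∀ i, Function.Injective (Prod.snd z i)),
      frameMk z hz ∈ O → ∀ᶠ z' : affineSpace (V × FrameMaps E d) in 𝓝 z,
        ∀ hz' : ∀ i, Function.Injective (Prod.snd z' i), frameMk z' hz' ∈ O) : IsOpen O := by
  refine isOpen_quot_iff.2 (isOpen_iff_mem_nhds.2 ?_)
  rintro ⟨z, hz⟩ hzO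
  have hmem := (IsMorphismAt.subVal (X := affineSpace (V × FrameMaps E d)) _ ⟨z, hz⟩).1.eventually
    (h z hz hzO)
  filter_upwards [hmem] with z' hz'
  exact hz' z'.2

theorem isMorphismAt_of_frames {Z : FunctionSpace} {O : Set (affineProdGrassmannians E d V)}
    (hO : IsOpen O) {φ : affineProdGrassmannians E d V → Z}
    {Ψ : affineSpace (V × FrameMaps E d) → Z}
    (h : ∀ (z : affineSpace (V × FrameMaps E d)) (hz : ∀ i, Function.Injective (Prod.snd z i)),
      frameMk z hz ∈ O → IsMorphismAt Ψ z)
    (hφ : ∀ (z : V × FrameMaps E d) (hz : ∀ i, Function.Injective (z.2 i)),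
      φ (frameMk z hz) = Ψ z) {y : affineProdGrassmannians E d V} (hy : y ∈ O) :
    IsMorphismAt φ y := by
  refine IsMorphismAt.quotLift hO (fun z hz => ?_) hy
  exact ((h z.1 z.2 hz).comp (IsMorphismAt.subVal _ z)).congr
    (Eventually.of_forall fun y => (hφ y.1 y.2).symm)

theorem isMorphismAt_affineProdGrassmannians_fst (y : affineProdGrassmannians E d V) :
    IsMorphismAt (X := affineProdGrassmannians E d V) (Y := affineSpace V)
      (fun z : V × GrPoint E d => z.1) y :=
  isMorphismAt_of_frames isOpen_univ (Z := affineSpace V)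
    (Ψ := fun z : (affineSpace (V × FrameMaps E d)).carrier => Prod.fst z)
    (fun _ _ _ => (regMapAt_id (M := V × FrameMaps E d) _).fst.isMorphismAt) (fun _ _ => rfl)
    (mem_univ _)

theorem isMorphismAt_affineProdGrassmannians_snd (y : affineProdGrassmannians E d V) :
    IsMorphismAt (X := affineProdGrassmannians E d V) (Y := grassmannians E d)
      (fun z : V × GrPoint E d => z.2) y := by
  refine IsMorphismAt.quotLift isOpen_univ (fun z _ => ?_) (mem_univ y)
  let L : Set (affineSpace (FrameMaps E d)) := {a : FrameMaps E d | ∀ i, Function.Injective (a i)}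
  let L' : Set (affineSpace (V × FrameMaps E d)) :=
    {z : V × FrameMaps E d | ∀ i, Function.Injective (z.2 i)}
  let φ : (affineSpace (V × FrameMaps E d)).sub L' → (affineSpace (FrameMaps E d)).sub L :=
    fun z => ⟨Prod.snd z.1, z.2⟩
  have hreg : ((affineSpace (V × FrameMaps E d)).sub L').RegMapAt (M := FrameMaps E d)
      (fun y => (φ y).1) z :=
    ((IsMorphismAt.subVal L' z).regMapAt (regMapAt_id (M := V × FrameMaps E d) _)).snd
  have hφ : IsMorphismAt φ z := IsMorphismAt.codRestrict hreg.isMorphismAt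
  exact (IsMorphismAt.toQuot (X := (affineSpace (FrameMaps E d)).sub L) (Q := GrPoint E d)
    (fun a => FrameMaps.span (E := E) (d := d) a.1 a.2) (φ z)).comp hφ

theorem isMorphismAt_grassmannians_mk (r : V) (y : grassmannians E d) :
    IsMorphismAt (X := grassmannians E d) (Y := affineProdGrassmannians E d V)
      (fun X : GrPoint E d => (r, X)) y := by
  refine IsMorphismAt.quotLift isOpen_univ (fun z _ => ?_) (mem_univ y)
  have h := (IsMorphismAt.subVal (X := affineSpace (FrameMaps E d)) _ z).regMapAt
    (regMapAt_id (M := FrameMaps E d) _)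
  exact isMorphismAt_of_frame_lift (Ψ := fun y => (r, y.1)) (RegMapAt.prodMk (.const r z) h)
    (Eventually.of_forall fun y => ⟨y.2, rfl⟩)

end FunctionSpace

end Frames

/-! ### Vector bundles over flag varieties -/

namespace FlagBundle

open FunctionSpace

variable {I₀ I₁ : Type} {H : I₁ → Type} {t : ∀ β, H β → I₀} {E : I₀ ⊕ I₁ → Type}
  [∀ i, AddCommGroup (E i)] [∀ i, Module ℂ (E i)]
  {N : I₁ → Type} [∀ β, AddCommGroup (N β)] [∀ β, Module ℂ (N β)]
  (e : ∀ β, E (.inr β) ≃ₗ[ℂ] N β × (∀ h : H β, E (.inl (t β h))))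
  {B : I₀ ⊕ I₁ → Type} [∀ i, AddCommGroup (B i)] [∀ i, Module ℂ (B i)]
  {V : Type} [AddCommGroup V] [Module ℂ V] (ρ : V ≃ₗ[ℂ] ∀ i, B i →ₗ[ℂ] E i)
  {v : I₀ ⊕ I₁ → ℕ}

variable (t N v) in
/-- The space `N β ⊕ ⨁_h ℂ ^ v (t h)`, which frames of the spaces `X (t h)` identify with
`N β ⊕ ⨁_h X (t h)`. -/
abbrev Middle (β : I₁) : Type := N β × (∀ h : H β, Fin (v (.inl (t β h))) → ℂ)

/-- The map `N β ⊕ ⨁_h ℂ ^ v (t h) → E β` given by maps `ℂ ^ v α → E α`. -/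
def up (a : ∀ α, (Fin (v (.inl α)) → ℂ) →ₗ[ℂ] E (.inl α)) (β : I₁) :
    Middle t N v β →ₗ[ℂ] E (.inr β) :=
  (e β).symm.toLinearMap ∘ₗ ((LinearMap.fst ℂ _ _).prod
    (LinearMap.pi fun h => a (t β h) ∘ₗ LinearMap.proj h ∘ₗ LinearMap.snd ℂ _ _))

/-- The map `E β → N β ⊕ ⨁_h ℂ ^ v (t h)` given by maps `E α → ℂ ^ v α`. -/
def down (p : ∀ α, E (.inl α) →ₗ[ℂ] (Fin (v (.inl α)) → ℂ)) (β : I₁) :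
    E (.inr β) →ₗ[ℂ] Middle t N v β :=
  ((LinearMap.fst ℂ _ _).prod
    (LinearMap.pi fun h => p (t β h) ∘ₗ LinearMap.proj h ∘ₗ LinearMap.snd ℂ _ _)) ∘ₗ
      (e β).toLinearMap

section UpDown

variable {p : ∀ α, E (.inl α) →ₗ[ℂ] (Fin (v (.inl α)) → ℂ)}
  {a : ∀ α, (Fin (v (.inl α)) → ℂ) →ₗ[ℂ] E (.inl α)}

theorem e_up (a : ∀ α, (Fin (v (.inl α)) → ℂ) →ₗ[ℂ] E (.inl α)) (β : I₁) (z : Middle t N v β) :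
    e β (up e a β z) = (z.1, fun h => a (t β h) (z.2 h)) := by
  rw [up, LinearMap.comp_apply, LinearEquiv.coe_coe, LinearEquiv.apply_symm_apply]
  rfl

theorem down_apply (p : ∀ α, E (.inl α) →ₗ[ℂ] (Fin (v (.inl α)) → ℂ)) (β : I₁)
    (x : E (.inr β)) : down e p β x = ((e β x).1, fun h => p (t β h) ((e β x).2 h)) := rfl

theorem down_comp_up (h : ∀ α, p α ∘ₗ a α = LinearMap.id) (β : I₁) :
    down e p β ∘ₗ up e a β = LinearMap.id := by
  have hpa : ∀ α z, p α (a α z) = z := fun α => LinearMap.congr_fun (h α)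
  refine LinearMap.ext fun z => ?_
  rw [LinearMap.comp_apply, down_apply, e_up]
  simp only [hpa, LinearMap.id_apply]

theorem up_injective (ha : ∀ α, Function.Injective (a α)) (β : I₁) :
    Function.Injective (up e a β) := by
  intro z z' h
  have hz := congrArg (e β) h
  rw [e_up, e_up, Prod.mk.injEq] at hz
  exact Prod.ext hz.1 (funext fun h => ha _ (congrFun hz.2 h))

theorem up_down (h : ∀ α, p α ∘ₗ a α = LinearMap.id) {β : I₁} {x : E (.inr β)}
    (hx : ∀ h, (e β x).2 h ∈ LinearMap.range (a (t β h))) : up e a β (down e p β x) = x := by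
  have hpa : ∀ α z, p α (a α z) = z := fun α => LinearMap.congr_fun (h α)
  apply (e β).injective
  rw [e_up, down_apply]
  refine Prod.ext rfl (funext fun h => ?_)
  obtain ⟨z, hz⟩ := hx h
  simp only [← hz, hpa]

end UpDown

variable (t E N B v) in
/-- Parameters for the bundle: frames of the `X α`, frames of the `X β` in `N β ⊕ ⨁_h ℂ ^ v (t h)`,
and the coordinates of the maps `B i → X i` in these frames. -/
abbrev Param : Type :=
  (∀ α, (Fin (v (.inl α)) → ℂ) →ₗ[ℂ] E (.inl α)) ×
  (∀ β, (Fin (v (.inr β)) → ℂ) →ₗ[ℂ] Middle t N v β) ×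
  (∀ i, B i →ₗ[ℂ] (Fin (v i) → ℂ))

/-- The frames of the `X i` given by a parameter. -/
def frameOf (x : Param t E N B v) : FrameMaps E v
  | .inl α => x.1 α
  | .inr β => up e x.1 β ∘ₗ x.2.1 β

/-- The vector of `V` given by a parameter. -/
def repOf (x : Param t E N B v) : V := ρ.symm fun i => frameOf e x i ∘ₗ x.2.2 i

theorem frameOf_injective {x : Param t E N B v} (h₀ : ∀ α, Function.Injective (x.1 α))
    (h₁ : ∀ β, Function.Injective (x.2.1 β)) : ∀ i, Function.Injective (frameOf e x i)
  | .inl α => h₀ α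
  | .inr β => (up_injective e h₀ β).comp (h₁ β)

/-- The flag condition `X β ⊆ N β ⊕ ⨁_h X (t h)`. -/
def IsFlag (X : GrPoint E v) : Prop :=
  ∀ β, ∀ z ∈ X.1 (.inr β), ∀ h, (e β z).2 h ∈ X.1 (.inl (t β h))

variable (v) in
/-- The total space of the bundle of families of maps `B i → X i` over the variety of flags `X`;
such a family is recorded as an element of `V` by means of `ρ`. -/
def bundleSet : Set (affineProdGrassmannians E v V) :=
  {z : V × GrPoint E v | IsFlag e z.2 ∧ ∀ i, LinearMap.range (ρ z.1 i) ≤ z.2.1 i}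

variable (v) in
/-- The bundle `bundleSet` as a variety. -/
def bundle : FunctionSpace := (affineProdGrassmannians E v V).sub (bundleSet e ρ v)

theorem frameMk_mem_bundleSet (x : Param t E N B v)
    (h : ∀ i, Function.Injective (frameOf e x i)) :
    frameMk (repOf e ρ x, frameOf e x) h ∈ bundleSet e ρ v := by
  constructor
  · rintro β _ ⟨z, rfl⟩ h
    change (e β (up e x.1 β (x.2.1 β z))).2 h ∈ LinearMap.range (x.1 (t β h))
    rw [e_up]
    exact ⟨_, rfl⟩
  · intro i
    change LinearMap.range (ρ (ρ.symm _) i) ≤ LinearMap.range (frameOf e x i)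
    rw [LinearEquiv.apply_symm_apply]
    exact LinearMap.range_comp_le_range _ _

/-- The point of the bundle given by a parameter. -/
def pointOf (x : Param t E N B v) (h : ∀ i, Function.Injective (frameOf e x i)) :
    bundle e ρ v :=
  ⟨frameMk (repOf e ρ x, frameOf e x) h, frameMk_mem_bundleSet e ρ x h⟩

section Regular

variable [∀ β, Finite (H β)] [∀ i, FiniteDimensional ℂ (E i)] [∀ β, FiniteDimensional ℂ (N β)]
  {X : FunctionSpace} {x : X}

theorem regMapAt_up {a : X → ∀ α, (Fin (v (.inl α)) → ℂ) →ₗ[ℂ] E (.inl α)} (h : X.RegMapAt a x)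
    (β : I₁) : X.RegMapAt (fun y => up e (a y) β) x :=
  RegMapAt.linComp (.const _ x) (RegMapAt.linProd (.const _ x) (RegMapAt.linPi fun _ =>
    RegMapAt.linComp (h.apply _) (.const _ x)))

variable [Finite I₀] [Finite I₁]

theorem regMapAt_frameOf {Ψ : X → Param t E N B v} (h : X.RegMapAt Ψ x) :
    X.RegMapAt (fun y => frameOf e (Ψ y)) x := by
  refine RegMapAt.pi fun i => ?_
  cases i with
  | inl α => exact h.fst.apply α
  | inr β => exact RegMapAt.linComp (regMapAt_up e h.fst β) (h.snd.fst.apply β)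

theorem regMapAt_repOf {Ψ : X → Param t E N B v} (h : X.RegMapAt Ψ x) :
    X.RegMapAt (fun y => repOf e ρ (Ψ y)) x :=
  RegMapAt.linear (RegMapAt.pi fun i => RegMapAt.linComp ((regMapAt_frameOf e h).apply i)
    (h.snd.snd.apply i)) ρ.symm.toLinearMap

theorem isMorphismAt_pointOf [IsLocallyRinged X] {Ψ : X → Param t E N B v} (h : X.RegMapAt Ψ x)
    (hΨ : ∀ y i, Function.Injective (frameOf e (Ψ y) i)) :
    IsMorphismAt (fun y => pointOf e ρ (Ψ y) (hΨ y)) x :=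
  IsMorphismAt.codRestrict (isMorphismAt_of_frame_lift
    ((regMapAt_repOf e ρ h).prodMk (regMapAt_frameOf e h))
    (Eventually.of_forall fun y => ⟨hΨ y, rfl⟩))

end Regular

/-! ### Charts of the bundle -/

variable (t E N v) in
/-- Frames of a flag together with retractions; they determine a chart, which consists of the
flags complementary to the kernels of the retractions. -/
structure SplitFrames where
  frame₀ : ∀ α, (Fin (v (.inl α)) → ℂ) →ₗ[ℂ] E (.inl α)
  frame₁ : ∀ β, (Fin (v (.inr β)) → ℂ) →ₗ[ℂ] Middle t N v β
  retr₀ : ∀ α, E (.inl α) →ₗ[ℂ] (Fin (v (.inl α)) → ℂ)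
  retr₁ : ∀ β, Middle t N v β →ₗ[ℂ] (Fin (v (.inr β)) → ℂ)
  retr₀_comp_frame₀ : ∀ α, retr₀ α ∘ₗ frame₀ α = LinearMap.id
  retr₁_comp_frame₁ : ∀ β, retr₁ β ∘ₗ frame₁ β = LinearMap.id

variable (σ : SplitFrames t E N v)

namespace SplitFrames

/-- The coordinates on `X i` for the flags `X` of a chart. -/
def coord : ∀ i, E i →ₗ[ℂ] (Fin (v i) → ℂ)
  | .inl α => σ.retr₀ α
  | .inr β => σ.retr₁ β ∘ₗ down e σ.retr₀ β

variable (B) in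
/-- The model space of a chart. -/
abbrev ChartModel : Type :=
  (∀ α, (Fin (v (.inl α)) → ℂ) →ₗ[ℂ] LinearMap.ker (σ.retr₀ α)) ×
  (∀ β, (Fin (v (.inr β)) → ℂ) →ₗ[ℂ] LinearMap.ker (σ.retr₁ β)) ×
  (∀ i, B i →ₗ[ℂ] (Fin (v i) → ℂ))

/-- The parameter of a point of the model space. -/
def chartParam (x : σ.ChartModel B) : Param t E N B v :=
  (fun α => σ.frame₀ α + (LinearMap.ker (σ.retr₀ α)).subtype ∘ₗ x.1 α,
    fun β => σ.frame₁ β + (LinearMap.ker (σ.retr₁ β)).subtype ∘ₗ x.2.1 β, x.2.2)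

theorem retr₀_comp_chartParam (x : σ.ChartModel B) (α : I₀) :
    σ.retr₀ α ∘ₗ (σ.chartParam x).1 α = LinearMap.id :=
  comp_add_subtype_ker (σ.retr₀_comp_frame₀ α) _

theorem retr₁_comp_chartParam (x : σ.ChartModel B) (β : I₁) :
    σ.retr₁ β ∘ₗ (σ.chartParam x).2.1 β = LinearMap.id :=
  comp_add_subtype_ker (σ.retr₁_comp_frame₁ β) _

theorem down_comp_frameOf_chartParam (x : σ.ChartModel B) (β : I₁) :
    down e σ.retr₀ β ∘ₗ frameOf e (σ.chartParam x) (.inr β) = (σ.chartParam x).2.1 β := by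
  rw [frameOf, ← LinearMap.comp_assoc, down_comp_up e (σ.retr₀_comp_chartParam x),
    LinearMap.id_comp]

theorem coord_comp_frameOf_chartParam (x : σ.ChartModel B) :
    ∀ i, σ.coord e i ∘ₗ frameOf e (σ.chartParam x) i = LinearMap.id
  | .inl α => σ.retr₀_comp_chartParam x α
  | .inr β => by
    rw [coord, LinearMap.comp_assoc, down_comp_frameOf_chartParam, retr₁_comp_chartParam]

theorem frameOf_chartParam_injective (x : σ.ChartModel B) (i : I₀ ⊕ I₁) :
    Function.Injective (frameOf e (σ.chartParam x) i) :=
  Function.LeftInverse.injective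
    (LinearMap.congr_fun (σ.coord_comp_frameOf_chartParam e x i))

/-- The point of the bundle with given coordinates. -/
def chartPoint (x : σ.ChartModel B) : bundle e ρ v :=
  pointOf e ρ (σ.chartParam x) (σ.frameOf_chartParam_injective e x)

/-- The coordinates of a point in a chart, computed from frames. -/
noncomputable def chartCoord (z : V × FrameMaps E v) : σ.ChartModel B :=
  (fun α => kerProj (σ.retr₀ α) (σ.frame₀ α) (σ.retr₀_comp_frame₀ α) ∘ₗ
      normalFrame (σ.coord e (.inl α)) (z.2 (.inl α)),
    fun β => kerProj (σ.retr₁ β) (σ.frame₁ β) (σ.retr₁_comp_frame₁ β) ∘ₗ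
      down e σ.retr₀ β ∘ₗ normalFrame (σ.coord e (.inr β)) (z.2 (.inr β)),
    fun i => σ.coord e i ∘ₗ ρ z.1 i)

theorem chartCoord_congr {z z' : V × FrameMaps E v} (hz : ∀ i, Function.Injective (z.2 i))
    (hz' : ∀ i, Function.Injective (z'.2 i)) (h : frameMk z hz = frameMk z' hz') :
    σ.chartCoord e ρ z = σ.chartCoord e ρ z' := by
  have hV : z.1 = z'.1 := congrArg (fun y : V × GrPoint E v => y.1) h
  have hrange : ∀ i, LinearMap.range (z.2 i) = LinearMap.range (z'.2 i) := fun i =>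
    congrArg (fun y : V × GrPoint E v => y.2.1 i) h
  simp only [chartCoord, hV, normalFrame_congr (hz _) (hz' _) (hrange _)]

variable (V) in
/-- The domain of a chart. -/
def chartDomain : Set (affineProdGrassmannians E v V) :=
  {z : V × GrPoint E v | ∀ i, Disjoint (z.2.1 i) (LinearMap.ker (σ.coord e i))}

theorem frameMk_mem_chartDomain {z : V × FrameMaps E v} (hz : ∀ i, Function.Injective (z.2 i)) :
    frameMk z hz ∈ σ.chartDomain e V ↔
      ∀ i, IsUnit (σ.coord e i ∘ₗ z.2 i : Module.End ℂ (Fin (v i) → ℂ)) :=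
  forall_congr' fun i => (isUnit_comp_iff_disjoint (hz i)).symm

theorem chartPoint_mem_chartDomain (x : σ.ChartModel B) :
    (σ.chartPoint e ρ x).1 ∈ σ.chartDomain e V :=
  (σ.frameMk_mem_chartDomain e _).2 fun i => by
    rw [coord_comp_frameOf_chartParam]
    exact isUnit_one

theorem chartCoord_chartParam (x : σ.ChartModel B) :
    σ.chartCoord e ρ (repOf e ρ (σ.chartParam x), frameOf e (σ.chartParam x)) = x := by
  have hcoord := σ.coord_comp_frameOf_chartParam e x
  refine Prod.ext (funext fun α => ?_) (Prod.ext (funext fun β => ?_) (funext fun i => ?_))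
  · simp only [chartCoord, normalFrame_eq_self (hcoord _)]
    exact kerProj_comp_add _ _
  · simp only [chartCoord, normalFrame_eq_self (hcoord _), down_comp_frameOf_chartParam]
    exact kerProj_comp_add _ _
  · simp only [chartCoord, repOf, LinearEquiv.apply_symm_apply, ← LinearMap.comp_assoc, hcoord,
      LinearMap.id_comp]
    rfl

theorem frameOf_chartParam_chartCoord {z : V × FrameMaps E v}
    (hunit : ∀ i, IsUnit (σ.coord e i ∘ₗ z.2 i : Module.End ℂ (Fin (v i) → ℂ)))
    (hflag : ∀ β y h, (e β (z.2 (.inr β) y)).2 h ∈ LinearMap.range (z.2 (.inl (t β h)))) :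
    ∀ i, frameOf e (σ.chartParam (σ.chartCoord e ρ z)) i = normalFrame (σ.coord e i) (z.2 i) := by
  have hsink : ∀ α, (σ.chartParam (σ.chartCoord e ρ z)).1 α =
      normalFrame (σ.coord e (.inl α)) (z.2 (.inl α)) := fun α =>
    add_subtype_comp_kerProj _ (comp_normalFrame (hunit (.inl α)))
  rintro (α | β)
  · exact hsink α
  · have hsource : (σ.chartParam (σ.chartCoord e ρ z)).2.1 β =
        down e σ.retr₀ β ∘ₗ normalFrame (σ.coord e (.inr β)) (z.2 (.inr β)) :=
      add_subtype_comp_kerProj _ (comp_normalFrame (hunit (.inr β)))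
    rw [frameOf, hsource]
    refine LinearMap.ext fun y => up_down e (σ.retr₀_comp_chartParam _) fun h => ?_
    rw [hsink, range_normalFrame (hunit _)]
    exact hflag β _ h

theorem chartPoint_chartCoord {z : V × FrameMaps E v} (hz : ∀ i, Function.Injective (z.2 i))
    (hzO : frameMk z hz ∈ σ.chartDomain e V) (hzS : frameMk z hz ∈ bundleSet e ρ v) :
    (σ.chartPoint e ρ (σ.chartCoord e ρ z)).1 = frameMk z hz := by
  have hunit := (σ.frameMk_mem_chartDomain e hz).1 hzO
  have hframe := σ.frameOf_chartParam_chartCoord e ρ hunit fun β y h => hzS.1 β _ ⟨y, rfl⟩ h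
  have hrange : ∀ i, LinearMap.range (frameOf e (σ.chartParam (σ.chartCoord e ρ z)) i) =
      LinearMap.range (z.2 i) := fun i => by rw [hframe, range_normalFrame (hunit i)]
  have hrep : repOf e ρ (σ.chartParam (σ.chartCoord e ρ z)) = z.1 := by
    rw [repOf, LinearEquiv.symm_apply_eq]
    exact funext fun i => comp_comp_eq_of_range_le (σ.coord_comp_frameOf_chartParam e _ i)
      ((hzS.2 i).trans (hrange i).ge)
  exact Prod.ext (α := V) (β := GrPoint E v) hrep (Subtype.ext (funext hrange))

section Regular

variable [Finite I₀] [Finite I₁] [∀ i, FiniteDimensional ℂ (E i)]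

theorem isOpen_chartDomain : IsOpen (σ.chartDomain e V) := by
  refine isOpen_of_frames fun z hz hzO => ?_
  have hunit : ∀ᶠ y : affineSpace (V × FrameMaps E v) in 𝓝 z, ∀ i,
      IsUnit (σ.coord e i ∘ₗ Prod.snd y i : Module.End ℂ (Fin (v i) → ℂ)) :=
    eventually_all.2 fun i => RegMapAt.eventually_isUnit
      (RegMapAt.linComp (.const (σ.coord e i) z)
        ((regMapAt_id (M := V × FrameMaps E v) z).snd.apply i))
      ((σ.frameMk_mem_chartDomain e hz).1 hzO i)
  filter_upwards [hunit] with y hy hy'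
  exact (σ.frameMk_mem_chartDomain e hy').2 hy

variable [∀ β, Finite (H β)] [∀ β, FiniteDimensional ℂ (N β)]

theorem regMapAt_chartParam {X : FunctionSpace} {x : X} {Ψ : X → σ.ChartModel B}
    (h : X.RegMapAt Ψ x) : X.RegMapAt (fun y => σ.chartParam (Ψ y)) x :=
  RegMapAt.prodMk
    (RegMapAt.pi fun α => RegMapAt.add (.const _ x) (RegMapAt.linComp (.const _ x)
      (h.fst.apply α)))
    (RegMapAt.prodMk (RegMapAt.pi fun β => RegMapAt.add (.const _ x)
      (RegMapAt.linComp (.const _ x) (h.snd.fst.apply β))) h.snd.snd)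

theorem regMapAt_chartCoord {z : affineSpace (V × FrameMaps E v)}
    (hz : ∀ i, Function.Injective (Prod.snd z i)) (hzO : frameMk z hz ∈ σ.chartDomain e V) :
    (affineSpace (V × FrameMaps E v)).RegMapAt (σ.chartCoord e ρ) z := by
  have hid : (affineSpace (V × FrameMaps E v)).RegMapAt (fun y : V × FrameMaps E v => y) z :=
    regMapAt_id _
  have hframe : ∀ i, (affineSpace (V × FrameMaps E v)).RegMapAt
      (fun y : V × FrameMaps E v => normalFrame (σ.coord e i) (y.2 i)) z := fun i =>
    (hid.snd.apply i).normalFrame _ ((σ.frameMk_mem_chartDomain e hz).1 hzO i)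
  exact RegMapAt.prodMk (RegMapAt.pi fun α => RegMapAt.linComp (.const _ z) (hframe _))
    (RegMapAt.prodMk (RegMapAt.pi fun β => RegMapAt.linComp (.const _ z)
      (RegMapAt.linComp (.const _ z) (hframe _)))
    (RegMapAt.pi fun i => RegMapAt.linComp (.const _ z)
      ((hid.fst.linear ρ.toLinearMap).apply i)))

/-- The chart of the bundle given by frames with retractions. -/
noncomputable def chart : AffineChart (bundle e ρ v) (σ.ChartModel B) where
  toFun := σ.chartPoint e ρ
  invFun y := σ.chartCoord e ρ (exists_frameMk_eq y.1).choose
  target := Subtype.val ⁻¹' σ.chartDomain e V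
  isOpen_target := (σ.isOpen_chartDomain e).preimage continuous_subtype_val
  mapsTo := σ.chartPoint_mem_chartDomain e ρ
  left_inv x := by
    obtain ⟨hz, hzx⟩ := (exists_frameMk_eq (σ.chartPoint e ρ x).1).choose_spec
    exact (σ.chartCoord_congr e ρ hz _ hzx).trans (σ.chartCoord_chartParam e ρ x)
  right_inv y hy := by
    obtain ⟨hz, hzy⟩ := (exists_frameMk_eq y.1).choose_spec
    exact Subtype.ext ((σ.chartPoint_chartCoord e ρ hz (hzy.symm ▸ hy) (hzy.symm ▸ y.2)).trans hzy)
  isMorphismAt_toFun x := isMorphismAt_pointOf e ρ (σ.regMapAt_chartParam (regMapAt_id _))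
    (σ.frameOf_chartParam_injective e)
  isMorphismAt_invFun y hy := by
    refine IsMorphismAt.comp (Z := affineSpace (σ.ChartModel B))
      (ψ := fun y : affineProdGrassmannians E v V =>
        σ.chartCoord e ρ (exists_frameMk_eq y).choose)
      ?_ (IsMorphismAt.subVal _ y)
    refine isMorphismAt_of_frames (Z := affineSpace (σ.ChartModel B)) (σ.isOpen_chartDomain e)
      (Ψ := σ.chartCoord (V := V) e ρ)
      (fun z hz hzO => (σ.regMapAt_chartCoord e ρ hz hzO).isMorphismAt) (fun z hz => ?_) hy
    obtain ⟨hz', hzz'⟩ := (exists_frameMk_eq (frameMk z hz)).choose_spec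
    exact σ.chartCoord_congr e ρ hz' hz hzz'

end Regular

end SplitFrames

/-! ### Irreducibility and dimension of the bundle -/

section FiniteDimensional

variable [∀ i, FiniteDimensional ℂ (E i)]

theorem exists_mem_chartDomain {y : affineProdGrassmannians E v V} (hy : y ∈ bundleSet e ρ v) :
    ∃ σ : SplitFrames t E N v, y ∈ σ.chartDomain e V := by
  obtain ⟨⟨r, f⟩, hf, rfl⟩ := exists_frameMk_eq y
  choose p hp using fun α => LinearMap.exists_leftInverse_of_injective (f (.inl α))
    (LinearMap.ker_eq_bot.2 (hf (.inl α)))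
  have hinj : ∀ β, Function.Injective (down e p β ∘ₗ f (.inr β)) := by
    intro β
    refine Function.Injective.of_comp (f := up e (fun α => f (.inl α)) β) ?_
    convert hf (.inr β) using 1
    exact funext fun z => up_down e hp fun h => hy.1 β _ ⟨z, rfl⟩ h
  choose q hq using fun β => LinearMap.exists_leftInverse_of_injective (down e p β ∘ₗ f (.inr β))
    (LinearMap.ker_eq_bot.2 (hinj β))
  let σ : SplitFrames t E N v :=
    ⟨fun α => f (.inl α), fun β => down e p β ∘ₗ f (.inr β), p, q, hp, hq⟩
  refine ⟨σ, (σ.frameMk_mem_chartDomain e hf).2 ?_⟩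
  have hcoord : ∀ i, σ.coord e i ∘ₗ f i = LinearMap.id
    | .inl α => hp α
    | .inr β => hq β
  intro i
  rw [hcoord]
  exact isUnit_one

theorem exists_pointOf_eq (y : bundle e ρ v) :
    ∃ (x : Param t E N B v) (h₀ : ∀ α, Function.Injective (x.1 α))
      (h₁ : ∀ β, Function.Injective (x.2.1 β)), pointOf e ρ x (frameOf_injective e h₀ h₁) = y := by
  obtain ⟨σ, hy⟩ := exists_mem_chartDomain e ρ y.2
  obtain ⟨z, hz, hzy⟩ := exists_frameMk_eq y.1
  refine ⟨σ.chartParam (σ.chartCoord e ρ z),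
    fun α => Function.LeftInverse.injective (LinearMap.congr_fun (σ.retr₀_comp_chartParam _ α)),
    fun β => Function.LeftInverse.injective (LinearMap.congr_fun (σ.retr₁_comp_chartParam _ β)),
    Subtype.ext ((σ.chartPoint_chartCoord e ρ hz (hzy ▸ hy) (hzy ▸ y.2)).trans hzy)⟩

section Irreducible

variable [Finite I₀] [Finite I₁] [∀ β, Finite (H β)] [∀ β, FiniteDimensional ℂ (N β)]

theorem isOpen_injective_params :
    IsOpen {x : affineSpace (Param t E N B v) |
      (∀ α, Function.Injective (Prod.fst x α)) ∧ ∀ β, Function.Injective ((Prod.snd x).1 β)} := by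
  rw [isOpen_iff_mem_nhds]
  rintro x ⟨h₀, h₁⟩
  have hid : (affineSpace (Param t E N B v)).RegMapAt (fun y : Param t E N B v => y) x :=
    regMapAt_id _
  exact Filter.Eventually.and
    (eventually_all.2 fun α => RegMapAt.eventually_injective (hid.fst.apply α) (h₀ α))
    (eventually_all.2 fun β => RegMapAt.eventually_injective (hid.snd.fst.apply β) (h₁ β))

variable (B) in
omit [Finite I₀] [Finite I₁] in
theorem exists_injective_param (h₀ : ∀ α, v (.inl α) ≤ Module.finrank ℂ (E (.inl α)))
    (h₁ : ∀ β, v (.inr β) ≤ Module.finrank ℂ (Middle t N v β)) :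
    ∃ x : Param t E N B v,
      (∀ α, Function.Injective (x.1 α)) ∧ ∀ β, Function.Injective (x.2.1 β) := by
  choose a ha using fun α => finrank_le_iff_exists_linearMap.1
    ((Module.finrank_fin_fun ℂ).trans_le (h₀ α))
  choose b hb using fun β => finrank_le_iff_exists_linearMap.1
    ((Module.finrank_fin_fun ℂ).trans_le (h₁ β))
  exact ⟨⟨a, b, 0⟩, ha, hb⟩

variable [∀ i, FiniteDimensional ℂ (B i)]

/-- The bundle is the image of the irreducible space of parameters with injective frames. -/
theorem irreducibleSpace_bundle (h₀ : ∀ α, v (.inl α) ≤ Module.finrank ℂ (E (.inl α)))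
    (h₁ : ∀ β, v (.inr β) ≤ Module.finrank ℂ (Middle t N v β)) :
    IrreducibleSpace (bundle e ρ v) := by
  let S : Set (affineSpace (Param t E N B v)) := {x |
      (∀ α, Function.Injective (Prod.fst x α)) ∧ ∀ β, Function.Injective ((Prod.snd x).1 β)}
  have hS : IsPreirreducible S := (PreirreducibleSpace.isPreirreducible_univ).open_subset
    isOpen_injective_params (subset_univ _)
  have hne : S.Nonempty := exists_injective_param B h₀ h₁
  have : PreirreducibleSpace ((affineSpace (Param t E N B v)).sub S) :=
    Subtype.preirreducibleSpace hS
  have : IrreducibleSpace ((affineSpace (Param t E N B v)).sub S) := ⟨hne.to_subtype⟩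
  let φ : (affineSpace (Param t E N B v)).sub S → bundle e ρ v := fun x =>
    pointOf e ρ x.1 (frameOf_injective e x.2.1 x.2.2)
  have hφ : Continuous φ := continuous_iff_continuousAt.2 fun x =>
    (isMorphismAt_pointOf e ρ (Ψ := fun x : (affineSpace (Param t E N B v)).sub S => x.1)
      ((IsMorphismAt.subVal S x).regMapAt (regMapAt_id _))
      fun x => frameOf_injective e x.2.1 x.2.2).1
  have hsurj : Function.Surjective φ := fun y => by
    obtain ⟨x, h₀, h₁, hx⟩ := exists_pointOf_eq e ρ y
    exact ⟨⟨x, h₀, h₁⟩, hx⟩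
  exact hsurj.irreducibleSpace hφ

end Irreducible

variable [∀ β, Fintype (H β)] [∀ β, FiniteDimensional ℂ (N β)]

variable (t N v) in
theorem finrank_middle (β : I₁) : (Module.finrank ℂ (Middle t N v β) : ℤ) =
    Module.finrank ℂ (N β) + ∑ h : H β, (v (.inl (t β h)) : ℤ) := by
  simp [Module.finrank_prod, Module.finrank_pi_fintype]

variable [Fintype I₀] [Fintype I₁]

variable (t E N v) in
/-- The dimension of the variety of flags. -/
noncomputable def flagDim : ℤ :=
  ∑ α, (v (.inl α) : ℤ) * (Module.finrank ℂ (E (.inl α)) - v (.inl α)) +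
  ∑ β, (v (.inr β) : ℤ) *
    (Module.finrank ℂ (N β) + ∑ h : H β, (v (.inl (t β h)) : ℤ) - v (.inr β))

variable [∀ i, FiniteDimensional ℂ (B i)]

variable (B) in
theorem SplitFrames.finrank_chartModel (σ : SplitFrames t E N v) :
    (Module.finrank ℂ (σ.ChartModel B) : ℤ) =
      flagDim t E N v + ∑ i, (Module.finrank ℂ (B i) : ℤ) * v i := by
  have hsink : ∀ α, (Module.finrank ℂ (LinearMap.ker (σ.retr₀ α)) : ℤ) =
      Module.finrank ℂ (E (.inl α)) - v (.inl α) := fun α => by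
    have h := finrank_ker_add_of_comp_eq_id (σ.retr₀_comp_frame₀ α)
    rw [Module.finrank_fin_fun] at h
    rw [← h, Nat.cast_add, add_sub_cancel_right]
  have hsource : ∀ β, (Module.finrank ℂ (LinearMap.ker (σ.retr₁ β)) : ℤ) =
      Module.finrank ℂ (N β) + ∑ h : H β, (v (.inl (t β h)) : ℤ) - v (.inr β) := fun β => by
    have h := finrank_ker_add_of_comp_eq_id (σ.retr₁_comp_frame₁ β)
    rw [Module.finrank_fin_fun] at h
    rw [← finrank_middle, ← h, Nat.cast_add, add_sub_cancel_right]
  simp only [Module.finrank_prod, Module.finrank_pi_fintype, Module.finrank_linearMap,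
    Module.finrank_self, Finset.sum_const, Finset.card_univ, Fintype.card_fin, smul_eq_mul,
    mul_one, Nat.cast_add, Nat.cast_sum, Nat.cast_mul, hsink, hsource, flagDim, add_assoc]

theorem isLocallyAffineSpace_bundle {n : ℕ}
    (hn : (n : ℤ) = flagDim t E N v + ∑ i, (Module.finrank ℂ (B i) : ℤ) * v i) :
    (bundle e ρ v).IsLocallyAffineSpace n := by
  intro y
  obtain ⟨σ, hy⟩ := exists_mem_chartDomain e ρ y.2
  have hfinrank : Module.finrank ℂ (σ.ChartModel B) = n := by
    exact_mod_cast (σ.finrank_chartModel B).trans hn.symm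
  exact ⟨(σ.chart e ρ).ofFinrankEq hfinrank, hy⟩

end FiniteDimensional

/-! ### The flag variety -/

variable (v) in
/-- The variety of flags. -/
def flagSpace : FunctionSpace := (grassmannians E v).sub {X : GrPoint E v | IsFlag e X}

/-- The identification of the zero space with the families of maps `0 → E i`; its bundle is the
flag variety. -/
def zeroEquiv : PUnit.{1} ≃ₗ[ℂ] ∀ i, PUnit.{1} →ₗ[ℂ] E i := 0

/-- The projection of the zero bundle to the flag variety. -/
def ofZeroBundle (z : bundle e (zeroEquiv (E := E)) v) : flagSpace e v := ⟨z.1.2, z.2.1⟩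

/-- The zero section of the zero bundle. -/
def toZeroBundle (X : flagSpace e v) : bundle e (zeroEquiv (E := E)) v :=
  ⟨(PUnit.unit, X.1), X.2, fun i => by
    rw [Subsingleton.elim (zeroEquiv (E := E) PUnit.unit i) 0, LinearMap.range_zero]
    exact bot_le⟩

theorem isMorphismAt_ofZeroBundle (z : bundle e (zeroEquiv (E := E)) v) :
    IsMorphismAt (ofZeroBundle e) z :=
  IsMorphismAt.codRestrict
    ((isMorphismAt_affineProdGrassmannians_snd z.1).comp (IsMorphismAt.subVal _ z))

theorem isMorphismAt_toZeroBundle (X : flagSpace e v) : IsMorphismAt (toZeroBundle e) X :=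
  IsMorphismAt.codRestrict
    ((isMorphismAt_grassmannians_mk PUnit.unit X.1).comp (IsMorphismAt.subVal _ X))

variable [∀ i, FiniteDimensional ℂ (E i)] [∀ β, FiniteDimensional ℂ (N β)]

theorem isLocallyAffineSpace_flagSpace [Fintype I₀] [Fintype I₁] [∀ β, Fintype (H β)] {n : ℕ}
    (hn : (n : ℤ) = flagDim t E N v) : (flagSpace e v).IsLocallyAffineSpace n := by
  intro X
  obtain ⟨c, hc⟩ := isLocallyAffineSpace_bundle e (zeroEquiv (E := E)) (n := n)
    (by simpa [Module.finrank_zero_of_subsingleton] using hn) (toZeroBundle e X)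
  exact ⟨c.ofIso (φ := ofZeroBundle e) (ψ := toZeroBundle e) (fun _ => rfl) (fun _ => rfl)
    (isMorphismAt_ofZeroBundle e) (isMorphismAt_toZeroBundle e), hc⟩

theorem irreducibleSpace_flagSpace [Finite I₀] [Finite I₁] [∀ β, Finite (H β)]
    (h₀ : ∀ α, v (.inl α) ≤ Module.finrank ℂ (E (.inl α)))
    (h₁ : ∀ β, v (.inr β) ≤ Module.finrank ℂ (Middle t N v β)) :
    IrreducibleSpace (flagSpace e v) := by
  have := irreducibleSpace_bundle e zeroEquiv h₀ h₁
  have hsurj : Function.Surjective (ofZeroBundle e (v := v)) := fun X => ⟨toZeroBundle e X, rfl⟩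
  exact hsurj.irreducibleSpace (isMorphism_iff.2 (isMorphismAt_ofZeroBundle e)).1

end FlagBundle

/-! ### Ranks of linear maps -/

section LinearAlgebra

variable {K V W : Type*} [Field K] [AddCommGroup V] [Module K V] [AddCommGroup W] [Module K W]

theorem exists_submodule_between [FiniteDimensional K V] {S P : Submodule K V} (hSP : S ≤ P)
    {k : ℕ} (hS : Module.finrank K S ≤ k) (hP : k ≤ Module.finrank K P) :
    ∃ U : Submodule K V, S ≤ U ∧ U ≤ P ∧ Module.finrank K U = k := by
  induction k, hS using Nat.le_induction with
  | base => exact ⟨S, le_rfl, hSP, rfl⟩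
  | succ k _ ih =>
    obtain ⟨U, hSU, hUP, hU⟩ := ih (by omega)
    obtain ⟨x, hxP, hxU⟩ := SetLike.exists_of_lt
      (lt_of_le_of_ne hUP fun h => by rw [← h, hU] at hP; omega)
    have hx : x ≠ 0 := fun h => hxU (h ▸ zero_mem _)
    refine ⟨U ⊔ Submodule.span K {x}, hSU.trans le_sup_left,
      sup_le hUP ((Submodule.span_singleton_le_iff_mem _ _).2 hxP), ?_⟩
    have hinf : U ⊓ Submodule.span K {x} = ⊥ := by
      rwa [← disjoint_iff, Submodule.disjoint_span_singleton' hx]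
    have hfinrank := Submodule.finrank_sup_add_finrank_inf_eq U (Submodule.span K {x})
    rwa [hinf, finrank_bot, finrank_span_singleton hx, hU] at hfinrank

theorem exists_surjective_of_finrank_le [FiniteDimensional K V] [FiniteDimensional K W]
    (h : Module.finrank K W ≤ Module.finrank K V) :
    ∃ f : V →ₗ[K] W, Function.Surjective f := by
  obtain ⟨g, hg⟩ := finrank_le_iff_exists_linearMap.1 h
  obtain ⟨f, hfg⟩ := g.exists_leftInverse_of_injective (LinearMap.ker_eq_bot.2 hg)
  exact ⟨f, Function.LeftInverse.surjective (LinearMap.congr_fun hfg)⟩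

theorem exists_injective_comp [FiniteDimensional K W] {f : V →ₗ[K] W} {k : ℕ}
    (h : k ≤ Module.finrank K (LinearMap.range f)) :
    ∃ j : (Fin k → K) →ₗ[K] V, Function.Injective (f ∘ₗ j) := by
  obtain ⟨g, hg⟩ := finrank_le_iff_exists_linearMap.1 ((Module.finrank_fin_fun K).trans_le h)
  obtain ⟨s, hs⟩ := LinearMap.exists_rightInverse_of_surjective f.rangeRestrict
    (LinearMap.range_rangeRestrict f)
  have hfsg : f ∘ₗ s ∘ₗ g = (LinearMap.range f).subtype ∘ₗ g :=
    LinearMap.ext fun z => congrArg Subtype.val (LinearMap.congr_fun hs (g z))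
  refine ⟨s ∘ₗ g, ?_⟩
  rw [hfsg]
  exact Subtype.val_injective.comp hg

theorem le_finrank_range_of_injective_comp [FiniteDimensional K W] {f : V →ₗ[K] W} {k : ℕ}
    {j : (Fin k → K) →ₗ[K] V} (h : Function.Injective (f ∘ₗ j)) :
    k ≤ Module.finrank K (LinearMap.range f) := by
  calc k = Module.finrank K (LinearMap.range (f ∘ₗ j)) := by
        rw [LinearMap.finrank_range_of_inj h, Module.finrank_fin_fun]
    _ ≤ _ := Submodule.finrank_mono (LinearMap.range_comp_le_range _ _)

theorem range_comp_eq_of_injective [FiniteDimensional K W] {f : V →ₗ[K] W} {k : ℕ}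
    {j : (Fin k → K) →ₗ[K] V} (h : Function.Injective (f ∘ₗ j))
    (hf : Module.finrank K (LinearMap.range f) = k) :
    LinearMap.range (f ∘ₗ j) = LinearMap.range f :=
  Submodule.eq_of_le_of_finrank_eq (LinearMap.range_comp_le_range _ _) (by
    rw [LinearMap.finrank_range_of_inj h, Module.finrank_fin_fun, hf])

end LinearAlgebra

namespace FunctionSpace

theorem RegMapAt.eventually_le_finrank_range {X : FunctionSpace} [IsLocallyRinged X]
    {x : X} {M N : Type} [AddCommGroup M] [Module ℂ M] [FiniteDimensional ℂ M] [AddCommGroup N]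
    [Module ℂ N] [FiniteDimensional ℂ N] {g : X → (M →ₗ[ℂ] N)} (h : X.RegMapAt g x) {k : ℕ}
    (hk : k ≤ Module.finrank ℂ (LinearMap.range (g x))) :
    ∀ᶠ y in 𝓝 x, k ≤ Module.finrank ℂ (LinearMap.range (g y)) := by
  obtain ⟨j, hj⟩ := exists_injective_comp hk
  filter_upwards [(linComp h (const j x)).eventually_injective hj] with y hy
  exact le_finrank_range_of_injective_comp hy

end FunctionSpace

namespace GradedQuiver

variable {I₀ I₁ : Type} {Ω : I₁ → I₀ → Type} {v w w' : I₀ ⊕ I₁ → ℕ}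

/-! ### Ranks of representations -/

/-- The space `W'_β ⊕ ⨁_{h : β → α} U_α`. -/
def flagSpaceAt (U : ∀ α, Submodule ℂ (Fin (w (.inl α)) → ℂ)) (β : I₁) :
    Submodule ℂ ((Fin (w' (.inr β)) → ℂ) × (∀ h : ArrowsFrom Ω β, Fin (w (.inl h.1)) → ℂ)) :=
  (⊤ : Submodule ℂ _).prod (Submodule.pi univ fun h => U h.1)

theorem mem_flagSpaceAt {U : ∀ α, Submodule ℂ (Fin (w (.inl α)) → ℂ)} {β : I₁}
    {z : (Fin (w' (.inr β)) → ℂ) × (∀ h : ArrowsFrom Ω β, Fin (w (.inl h.1)) → ℂ)} :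
    z ∈ flagSpaceAt U β ↔ ∀ h, z.2 h ∈ U h.1 := by
  simp [flagSpaceAt, Submodule.mem_prod, Submodule.mem_pi]

section Rank

variable [Fintype I₁] [∀ β α, Fintype (Ω β α)]

theorem sinkMap_apply (r : Rep Ω w w') (α : I₀) (z) :
    sinkMap r α z = r.1 α z.1 + ∑ h : ArrowsTo Ω α, r.2.2 h.1 α h.2 (z.2 h) := by
  simp [sinkMap, LinearMap.coprod_apply, LinearMap.sum_apply]

theorem sourceMap_apply_mem_range_sinkMap (r : Rep Ω w w') (β : I₁) (b : Fin (w (.inr β)) → ℂ)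
    (h : ArrowsFrom Ω β) : (sourceMap r β b).2 h ∈ LinearMap.range (sinkMap r h.1) := by
  classical
  refine ⟨(0, Pi.single ⟨β, h.2⟩ b), ?_⟩
  rw [sinkMap_apply, Finset.sum_eq_single ⟨β, h.2⟩]
  · simp only [map_zero, Pi.single_eq_same, zero_add]
    rfl
  · intro k _ hk
    simp only [Pi.single_eq_of_ne hk, map_zero]
  · simp

theorem rankA_inl_le (r : Rep Ω w w') (α : I₀) :
    rankA r (.inl α) ≤ w' (.inl α) + ∑ h : ArrowsTo Ω α, rankA r (.inr h.1) := by
  let f : (Fin (w' (.inl α)) → ℂ) × (∀ h : ArrowsTo Ω α, LinearMap.range (sourceMap r h.1)) →ₗ[ℂ]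
      (Fin (w (.inl α)) → ℂ) :=
    (r.1 α).coprod (∑ h : ArrowsTo Ω α, LinearMap.proj (R := ℂ)
        (φ := fun k : ArrowsFrom Ω h.1 => Fin (w (.inl k.1)) → ℂ) ⟨α, h.2⟩ ∘ₗ
      LinearMap.snd ℂ _ _ ∘ₗ (LinearMap.range (sourceMap r h.1)).subtype ∘ₗ LinearMap.proj h)
  have hrange : LinearMap.range (sinkMap r α) ≤ LinearMap.range f := by
    rintro _ ⟨z, rfl⟩
    refine ⟨(z.1, fun h => (sourceMap r h.1).rangeRestrict (z.2 h)), ?_⟩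
    simp only [f, LinearMap.coprod_apply, LinearMap.sum_apply, sinkMap_apply]
    rfl
  refine (Submodule.finrank_mono hrange).trans (f.finrank_range_le.trans_eq ?_)
  rw [Module.finrank_prod, Module.finrank_fin_fun, Module.finrank_pi_fintype]
  rfl

theorem range_sourceMap_le_flagSpaceAt {r : Rep Ω w w'}
    {U : ∀ α, Submodule ℂ (Fin (w (.inl α)) → ℂ)}
    (h : ∀ α, LinearMap.range (sinkMap r α) ≤ U α) (β : I₁) :
    LinearMap.range (sourceMap r β) ≤ flagSpaceAt U β := by
  rintro _ ⟨b, rfl⟩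
  exact mem_flagSpaceAt.2 fun k => h k.1 (sourceMap_apply_mem_range_sinkMap r β b k)

theorem rankA_le (r : Rep Ω w w') : ∀ i, rankA r i ≤ w i
  | .inl α => (Submodule.finrank_le (LinearMap.range (sinkMap r α))).trans_eq
      (Module.finrank_fin_fun ℂ)
  | .inr β => (sourceMap r β).finrank_range_le.trans_eq (Module.finrank_fin_fun ℂ)

end Rank

variable [Fintype I₀] [∀ β α, Fintype (Ω β α)]

theorem finrank_flagSpaceAt (U : ∀ α, Submodule ℂ (Fin (w (.inl α)) → ℂ)) (β : I₁) :
    Module.finrank ℂ (flagSpaceAt (Ω := Ω) (w' := w') U β) =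
      w' (.inr β) + ∑ h : ArrowsFrom Ω β, Module.finrank ℂ (U h.1) := by
  let e : flagSpaceAt (Ω := Ω) (w' := w') U β ≃ₗ[ℂ]
      (Fin (w' (.inr β)) → ℂ) × (∀ h : ArrowsFrom Ω β, U h.1) :=
    { toFun := fun z => (z.1.1, fun h => ⟨z.1.2 h, mem_flagSpaceAt.1 z.2 h⟩)
      map_add' := fun _ _ => rfl
      map_smul' := fun _ _ => rfl
      invFun := fun z => ⟨(z.1, fun h => z.2 h), mem_flagSpaceAt.2 fun h => (z.2 h).2⟩
      left_inv := fun _ => rfl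
      right_inv := fun _ => rfl }
  rw [e.finrank_eq, Module.finrank_prod, Module.finrank_fin_fun, Module.finrank_pi_fintype]

variable [Fintype I₁]

theorem rankA_inr_le (r : Rep Ω w w') (β : I₁) :
    rankA r (.inr β) ≤ w' (.inr β) + ∑ h : ArrowsFrom Ω β, rankA r (.inl h.1) :=
  (Submodule.finrank_mono (range_sourceMap_le_flagSpaceAt (fun _ => le_rfl) β)).trans_eq
    (finrank_flagSpaceAt _ β)

theorem rankA_le_add_adjSum (r : Rep Ω w w') : ∀ i, rankA r i ≤ w' i + adjSum Ω (rankA r) i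
  | .inl α => rankA_inl_le r α
  | .inr β => rankA_inr_le r β

/-! ### `l`-dominance -/

theorem lDominant_iff {u : I₀ ⊕ I₁ → ℕ} :
    LDominant Ω u w w' ↔ ∀ i, u i ≤ w i ∧ u i ≤ w' i + adjSum Ω u i :=
  forall_congr' fun i => by omega

theorem lDominant_rankA (r : Rep Ω w w') : LDominant Ω (rankA r) w w' :=
  lDominant_iff.2 fun i => ⟨rankA_le r i, rankA_le_add_adjSum r i⟩

/-- Two vertices joined by an arrow. -/
def Joined (Ω : I₁ → I₀ → Type) : I₀ ⊕ I₁ → I₀ ⊕ I₁ → Prop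
  | .inl α, .inr β => Nonempty (Ω β α)
  | .inr β, .inl α => Nonempty (Ω β α)
  | _, _ => False

omit [Fintype I₀] [Fintype I₁] [∀ β α, Fintype (Ω β α)] in
theorem Joined.symm {i j : I₀ ⊕ I₁} (h : Joined Ω i j) : Joined Ω j i := by
  cases i <;> cases j <;> exact h

theorem adjSum_mono {u u' : I₀ ⊕ I₁ → ℕ} (h : u ≤ u') : adjSum Ω u ≤ adjSum Ω u'
  | .inl _ => Finset.sum_le_sum fun _ _ => h _
  | .inr _ => Finset.sum_le_sum fun _ _ => h _

theorem Joined.le_adjSum {i j : I₀ ⊕ I₁} (h : Joined Ω i j) (u : I₀ ⊕ I₁ → ℕ) :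
    u j ≤ adjSum Ω u i :=
  match i, j, h with
  | .inl α, .inr β, ⟨k⟩ => Finset.single_le_sum (f := fun h : ArrowsTo Ω α => u (.inr h.1))
      (fun _ _ => Nat.zero_le _) (Finset.mem_univ ⟨β, k⟩)
  | .inr β, .inl α, ⟨k⟩ => Finset.single_le_sum (f := fun h : ArrowsFrom Ω β => u (.inl h.1))
      (fun _ _ => Nat.zero_le _) (Finset.mem_univ ⟨α, k⟩)

theorem adjSum_congr {u u' : I₀ ⊕ I₁ → ℕ} {i : I₀ ⊕ I₁} (h : ∀ j, Joined Ω i j → u j = u' j) :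
    adjSum Ω u i = adjSum Ω u' i :=
  match i with
  | .inl _ => Finset.sum_congr rfl fun k _ => h (.inr k.1) ⟨k.2⟩
  | .inr _ => Finset.sum_congr rfl fun k _ => h (.inl k.1) ⟨k.2⟩

theorem vbar_le : vbar Ω v w w' ≤ v := fun _ => min_le_left _ _

/-- If `v̄ j < min (v j) (w j)` for a vertex `j` joined to `i`, then the term `min (v i) (w i)` of
the minimum `v̄ j` already bounds `v̄ i`. -/
theorem lDominant_vbar : LDominant Ω (vbar Ω v w w') w w' := by
  refine lDominant_iff.2 fun i => ⟨(min_le_right _ _).trans (min_le_left _ _), ?_⟩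
  by_cases hall : ∀ j, Joined Ω i j → vbar Ω v w w' j = min (v j) (w j)
  · rw [adjSum_congr hall]
    exact (min_le_right _ _).trans (min_le_right _ _)
  · push Not at hall
    obtain ⟨j, hij, hj⟩ := hall
    calc vbar Ω v w w' i
        ≤ min (v i) (w i) := by simp only [vbar]; omega
      _ ≤ adjSum Ω (fun j => min (v j) (w j)) j := hij.symm.le_adjSum fun j => min (v j) (w j)
      _ ≤ vbar Ω v w w' j := by simp only [vbar] at hj ⊢; omega
      _ ≤ adjSum Ω (vbar Ω v w w') i := hij.le_adjSum _
      _ ≤ w' i + adjSum Ω (vbar Ω v w w') i := Nat.le_add_left _ _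

theorem isGreatest_vbar : IsGreatest {u | u ≤ v ∧ LDominant Ω u w w'} (vbar Ω v w w') := by
  refine ⟨⟨vbar_le, lDominant_vbar⟩, fun u ⟨huv, hu⟩ i => ?_⟩
  rw [lDominant_iff] at hu
  have hmin : u ≤ fun j => min (v j) (w j) := fun j => le_min (huv j) (hu j).1
  exact le_min (huv i) (le_min (hu i).1
    ((hu i).2.trans (Nat.add_le_add_left (adjSum_mono hmin i) _)))

theorem vbar_eq_of_lDominant (h : LDominant Ω v w w') : vbar Ω v w w' = v :=
  le_antisymm vbar_le (isGreatest_vbar.2 ⟨le_rfl, h⟩)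

theorem LDominant.nonemptyCondition (h : LDominant Ω v w w') : NonemptyCondition Ω v w w' :=
  ⟨fun α => (lDominant_iff.1 h (.inl α)).1, fun β => (lDominant_iff.1 h (.inr β)).2⟩

theorem affineSet_vbar : affineSet Ω v w w' = affineSet Ω (vbar Ω v w w') w w' :=
  Subset.antisymm (fun r hr => isGreatest_vbar.2 ⟨hr, lDominant_rankA r⟩)
    fun _ hr i => (hr i).trans (vbar_le i)

/-! ### Dimension formulas -/

variable (Ω v w w') in
theorem dimF_eq : dimF Ω v w w' =
    ∑ α, (w (.inl α) : ℤ) * v (.inl α) + ∑ β, (w' (.inr β) : ℤ) * v (.inr β)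
      - ∑ i, (v i : ℤ) ^ 2 + ∑ β, ∑ α, ∑ _h : Ω β α, (v (.inr β) : ℤ) * v (.inl α) := by
  have harrows : ∀ β, ∑ h : ArrowsFrom Ω β, (v (.inl h.1) : ℤ) * v (.inr β) =
      ∑ α, ∑ _h : Ω β α, (v (.inr β) : ℤ) * v (.inl α) := fun β => by
    rw [Fintype.sum_sigma]
    simp only [mul_comm]
  simp only [dimF, Fintype.sum_sum_type, sub_mul, add_mul, Finset.sum_mul, harrows,
    Finset.sum_sub_distrib, Finset.sum_add_distrib, pow_two]
  ring

variable (Ω v w w') in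
theorem dimFtilde_eq : dimFtilde Ω v w w' =
    ∑ α, ((w (.inl α) : ℤ) + w' (.inl α)) * v (.inl α)
      + ∑ β, ((w (.inr β) : ℤ) + w' (.inr β)) * v (.inr β)
      - ∑ i, (v i : ℤ) ^ 2 + ∑ β, ∑ α, ∑ _h : Ω β α, (v (.inr β) : ℤ) * v (.inl α) := by
  rw [dimFtilde, dimF_eq]
  simp only [add_mul, Finset.sum_add_distrib, mul_comm (v _ : ℤ) (w _ : ℤ),
    mul_comm (v _ : ℤ) (w' _ : ℤ)]
  ring

theorem NonemptyCondition.dimF_nonneg (h : NonemptyCondition Ω v w w') : 0 ≤ dimF Ω v w w' := by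
  refine add_nonneg (Finset.sum_nonneg fun β _ => mul_nonneg ?_ (Nat.cast_nonneg _))
    (Finset.sum_nonneg fun α _ => mul_nonneg ?_ (Nat.cast_nonneg _))
  · have := h.2 β
    zify at this
    linarith
  · have := h.1 α
    zify at this
    linarith

theorem NonemptyCondition.dimFtilde_nonneg (h : NonemptyCondition Ω v w w') :
    0 ≤ dimFtilde Ω v w w' := by
  have := h.dimF_nonneg
  unfold dimFtilde
  positivity

end GradedQuiver

/-! ### Graded quiver varieties as bundles over flag varieties -/

namespace GradedQuiver

open FunctionSpace FlagBundle

variable {I₀ I₁ : Type} {Ω : I₁ → I₀ → Type} {v w w' : I₀ ⊕ I₁ → ℕ}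

/-- The dimension of the space on which a representation is described freely: `W'_α` for a sink
`α`, where the arrows into `α` are described at their sources, and `W_β` for a source `β`. -/
abbrev sourceDim (w w' : I₀ ⊕ I₁ → ℕ) : I₀ ⊕ I₁ → ℕ
  | .inl α => w' (.inl α)
  | .inr β => w (.inr β)

variable (Ω w w') in
/-- The decomposition of the target of `A_β`. -/
def targetEquiv (β : I₁) : Target Ω w w' (.inr β) ≃ₗ[ℂ]
    (Fin (w' (.inr β)) → ℂ) × (∀ h : ArrowsFrom Ω β, Target Ω w w' (.inl h.1)) :=
  LinearEquiv.refl ℂ ((Fin (w' (.inr β)) → ℂ) × (∀ h : ArrowsFrom Ω β, Fin (w (.inl h.1)) → ℂ))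

variable (Ω w w') in
/-- A representation is determined by the maps `x_α` and `A_β`. -/
def repEquiv : Rep Ω w w' ≃ₗ[ℂ] ∀ i, (Fin (sourceDim w w' i) → ℂ) →ₗ[ℂ] Target Ω w w' i where
  toFun r
    | .inl α => r.1 α
    | .inr β => sourceMap r β
  map_add' _ _ := funext fun | .inl _ => rfl | .inr _ => rfl
  map_smul' _ _ := funext fun | .inl _ => rfl | .inr _ => rfl
  invFun s := (fun α => s (.inl α), fun β => LinearMap.fst ℂ _ _ ∘ₗ s (.inr β),
    fun β α h => LinearMap.proj (R := ℂ) (φ := fun h : ArrowsFrom Ω β => Fin (w (.inl h.1)) → ℂ)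
      ⟨α, h⟩ ∘ₗ LinearMap.snd ℂ _ _ ∘ₗ s (.inr β))
  left_inv _ := rfl
  right_inv _ := funext fun | .inl _ => rfl | .inr _ => rfl

theorem flagVariety_eq : flagVariety Ω v w w' = flagSpace (targetEquiv Ω w w') v := rfl

section

variable [Fintype I₀] [∀ β α, Fintype (Ω β α)]

theorem NonemptyCondition.le_finrank_target (h : NonemptyCondition Ω v w w') (α : I₀) :
    v (.inl α) ≤ Module.finrank ℂ (Target Ω w w' (.inl α)) :=
  (h.1 α).trans_eq (Module.finrank_fin_fun ℂ).symm

theorem NonemptyCondition.le_finrank_middle (h : NonemptyCondition Ω v w w') (β : I₁) :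
    v (.inr β) ≤ Module.finrank ℂ (Middle (fun β (h : ArrowsFrom Ω β) => h.1)
      (fun β => Fin (w' (.inr β)) → ℂ) v β) := by
  have hmiddle := finrank_middle (fun β (h : ArrowsFrom Ω β) => h.1)
    (fun β => Fin (w' (.inr β)) → ℂ) v β
  rw [Module.finrank_fin_fun] at hmiddle
  exact (h.2 β).trans_eq (by exact_mod_cast hmiddle.symm)

theorem irreducibleSpace_flagVariety [Finite I₁] (h : NonemptyCondition Ω v w w') :
    IrreducibleSpace (flagVariety Ω v w w') := by
  rw [flagVariety_eq]
  exact irreducibleSpace_flagSpace _ h.le_finrank_target h.le_finrank_middle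

end

variable [Fintype I₁] [∀ β α, Fintype (Ω β α)]

theorem nonsingularSet_eq :
    nonsingularSet Ω v w w' = bundleSet (targetEquiv Ω w w') (repEquiv Ω w w') v := by
  ext ⟨r, X⟩
  refine and_congr_right fun hX => ⟨fun h => ?_, fun h => ?_⟩
  · rintro (α | β)
    · rintro _ ⟨z, rfl⟩
      refine h (.inl α) ⟨(z, 0), ?_⟩
      rw [sinkMap_apply]
      simp only [Pi.zero_apply, map_zero, Finset.sum_const_zero, add_zero]
      rfl
    · exact h (.inr β)
  · rintro (α | β)
    · rintro _ ⟨z, rfl⟩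
      rw [sinkMap_apply]
      exact Submodule.add_mem _ (h (.inl α) ⟨z.1, rfl⟩) (Submodule.sum_mem _ fun k _ =>
        hX k.1 (sourceMap r k.1 (z.2 k)) (h (.inr k.1) ⟨z.2 k, rfl⟩) ⟨α, k.2⟩)
    · exact h (.inr β)

theorem nonsingularVariety_eq :
    nonsingularVariety Ω v w w' = bundle (targetEquiv Ω w w') (repEquiv Ω w w') v :=
  congrArg (affineProdGrassmannians (Target Ω w w') v (Rep Ω w w')).sub nonsingularSet_eq

/-! ### Rank conditions on representations -/

instance : IsLocallyRinged (repSpace Ω w w') := inferInstanceAs (IsLocallyRinged (affineSpace _))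

instance : IsLocallyRinged (affineVariety Ω v w w') := inferInstanceAs (IsLocallyRinged (sub _ _))

section Regular

variable {X : FunctionSpace} {Ψ : X → Rep Ω w w'} {x : X}

omit [Fintype I₁] [∀ β α, Fintype (Ω β α)] in
theorem regMapAt_sourceMap (h : X.RegMapAt Ψ x) (β : I₁) :
    X.RegMapAt (fun y => sourceMap (Ψ y) β) x :=
  (h.linear (repEquiv Ω w w').toLinearMap).apply (.inr β)

theorem regMapAt_sinkMap (h : X.RegMapAt Ψ x) (α : I₀) :
    X.RegMapAt (fun y => sinkMap (Ψ y) α) x :=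
  RegMapAt.add (RegMapAt.linComp (h.fst.apply α) (.const (LinearMap.fst ℂ _ _) x))
    (RegMapAt.linComp (RegMapAt.sum Finset.univ fun k _ => RegMapAt.linComp
      (((h.snd.snd.apply k.1).apply α).apply k.2) (.const (LinearMap.proj k) x))
      (.const (LinearMap.snd ℂ _ _) x))

theorem eventually_le_rankA [Finite I₀] [IsLocallyRinged X] (h : X.RegMapAt Ψ x) {k : ℕ}
    {i : I₀ ⊕ I₁} (hk : k ≤ rankA (Ψ x) i) : ∀ᶠ y in 𝓝 x, k ≤ rankA (Ψ y) i := by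
  cases i with
  | inl α => exact (regMapAt_sinkMap h α).eventually_le_finrank_range hk
  | inr β => exact (regMapAt_sourceMap h β).eventually_le_finrank_range hk

end Regular

theorem isOpen_le_rankA [Finite I₀] (k : ℕ) (i : I₀ ⊕ I₁) :
    IsOpen {r : repSpace Ω w w' | k ≤ rankA r i} :=
  isOpen_iff_mem_nhds.2 fun _ hr =>
    eventually_le_rankA (X := repSpace Ω w w') (regMapAt_id (M := Rep Ω w w') _) hr

theorem stratum_subset_affineSet : stratum Ω v w w' ⊆ affineSet Ω v w w' :=
  fun _ hr i => (hr i).le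

theorem isClosed_affineSet [Finite I₀] : IsClosed (affineSet Ω v w w') := by
  have hcompl : affineSet Ω v w w' = ⋂ i, {r : repSpace Ω w w' | v i + 1 ≤ rankA r i}ᶜ := by
    ext r
    simp only [mem_iInter, mem_compl_iff, mem_ofPred_eq, not_le, Nat.lt_succ_iff]
    rfl
  rw [hcompl]
  exact isClosed_iInter fun i => (isOpen_le_rankA _ _).isClosed_compl

variable (Ω v w w') in
/-- The stratum `E°_{u,w}` intersected with `E_{v,w}`, as a subset of the variety `E_{v,w}`. -/
abbrev stratumIn (u : I₀ ⊕ I₁ → ℕ) : Set (affineVariety Ω v w w') :=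
  {z | z.1 ∈ stratum Ω u w w'}

theorem isOpen_stratumIn [Finite I₀] {u : I₀ ⊕ I₁ → ℕ}
    (hu : affineSet Ω v w w' ⊆ affineSet Ω u w w') :
    IsOpen (stratumIn Ω v w w' u) := by
  have hrank : stratumIn Ω v w w' u =
      Subtype.val ⁻¹' ⋂ i, {r : repSpace Ω w w' | u i ≤ rankA r i} := by
    ext z
    change _ ↔ z.1 ∈ ⋂ i, {r : repSpace Ω w w' | u i ≤ rankA r i}
    rw [mem_iInter]
    exact forall_congr' fun i => ⟨fun h => h.ge, fun h => le_antisymm (hu z.2 i) h⟩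
  rw [hrank]
  exact (isOpen_iInter_of_finite fun i => isOpen_le_rankA _ _).preimage continuous_subtype_val

/-! ### Parameters -/

variable (Ω v w w') in
/-- Frames of a point of `F_{v,w}` together with the coordinates of the maps `x_α` and `A_β` in
these frames. -/
abbrev QuiverParam : Type :=
  Param (fun β (h : ArrowsFrom Ω β) => h.1) (Target Ω w w') (fun β => Fin (w' (.inr β)) → ℂ)
    (fun i => Fin (sourceDim w w' i) → ℂ) v

/-- The representation of a parameter. -/
def QuiverParam.rep (x : QuiverParam Ω v w w') : Rep Ω w w' :=
  repOf (targetEquiv Ω w w') (repEquiv Ω w w') x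

/-- The component `ℂ ^ v (s h) → ℂ ^ v_α` of a parameter, for an arrow `h` with target `α`. -/
def arrowCoord (x : QuiverParam Ω v w w') {α : I₀} (h : ArrowsTo Ω α) :
    (Fin (v (.inr h.1)) → ℂ) →ₗ[ℂ] (Fin (v (.inl α)) → ℂ) :=
  LinearMap.proj (R := ℂ) (φ := fun h : ArrowsFrom Ω h.1 => Fin (v (.inl h.1)) → ℂ) ⟨α, h.2⟩ ∘ₗ
    LinearMap.snd ℂ _ _ ∘ₗ x.2.1 h.1

/-- The map `W'_α ⊕ ⨁_h ℂ ^ v (s h) → ℂ ^ v_α` that induces `A_α`. -/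
def sinkCoord (x : QuiverParam Ω v w w') (α : I₀) :
    ((Fin (w' (.inl α)) → ℂ) × (∀ h : ArrowsTo Ω α, Fin (v (.inr h.1)) → ℂ)) →ₗ[ℂ]
      (Fin (v (.inl α)) → ℂ) :=
  (x.2.2 (.inl α)).coprod (∑ h : ArrowsTo Ω α, arrowCoord x h ∘ₗ LinearMap.proj h)

theorem sinkCoord_apply (x : QuiverParam Ω v w w') (α : I₀) (z) :
    sinkCoord x α z = x.2.2 (.inl α) z.1 +
      ∑ h : ArrowsTo Ω α, (x.2.1 h.1 (z.2 h)).2 ⟨α, h.2⟩ := by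
  simp only [sinkCoord, LinearMap.coprod_apply, LinearMap.sum_apply]
  rfl

theorem sinkMap_rep (x : QuiverParam Ω v w w') (α : I₀) :
    sinkMap x.rep α = x.1 α ∘ₗ sinkCoord x α ∘ₗ
      LinearMap.id.prodMap (LinearMap.pi fun h : ArrowsTo Ω α =>
        x.2.2 (.inr h.1) ∘ₗ LinearMap.proj h) := by
  refine LinearMap.ext fun z => ?_
  rw [sinkMap_apply, LinearMap.comp_apply, LinearMap.comp_apply, sinkCoord_apply, map_add, map_sum]
  rfl

omit [Fintype I₁] [∀ β α, Fintype (Ω β α)] in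
theorem sourceMap_rep (x : QuiverParam Ω v w w') (β : I₁) :
    sourceMap x.rep β =
      (up (targetEquiv Ω w w') x.1 β ∘ₗ x.2.1 β) ∘ₗ x.2.2 (.inr β) := rfl

theorem rankA_rep {x : QuiverParam Ω v w w'} (h₁ : ∀ α, Function.Injective (x.1 α))
    (h₂ : ∀ β, Function.Injective (x.2.1 β)) (h₃ : ∀ β, Function.Surjective (x.2.2 (.inr β)))
    (h₄ : ∀ α, Function.Surjective (sinkCoord x α)) (i : I₀ ⊕ I₁) : rankA x.rep i = v i := by
  cases i with
  | inl α =>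
    change Module.finrank ℂ (LinearMap.range (sinkMap _ α)) = _
    rw [sinkMap_rep, LinearMap.range_comp_of_range_eq_top,
      LinearMap.finrank_range_of_inj (h₁ α), Module.finrank_fin_fun]
    refine LinearMap.range_eq_top.2 ((h₄ α).comp fun z => ?_)
    choose y hy using fun h : ArrowsTo Ω α => h₃ h.1 (z.2 h)
    exact ⟨(z.1, y), Prod.ext rfl (funext hy)⟩
  | inr β =>
    have hframe : Function.Injective (up (targetEquiv Ω w w') x.1 β ∘ₗ x.2.1 β) :=
      (up_injective _ h₁ β).comp (h₂ β)
    change Module.finrank ℂ (LinearMap.range (sourceMap _ β)) = _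
    rw [sourceMap_rep, LinearMap.range_comp_of_range_eq_top _ (LinearMap.range_eq_top.2 (h₃ β)),
      LinearMap.finrank_range_of_inj hframe, Module.finrank_fin_fun]

section Regular

variable [Finite I₀] {X : FunctionSpace} {Ψ : X → QuiverParam Ω v w w'} {x : X}

omit [Fintype I₁] [∀ β α, Fintype (Ω β α)] in
theorem regMapAt_arrowCoord [∀ β α, Finite (Ω β α)] (h : X.RegMapAt Ψ x) {α : I₀}
    (k : ArrowsTo Ω α) : X.RegMapAt (fun y => arrowCoord (Ψ y) k) x :=
  RegMapAt.linComp (.const _ x) (RegMapAt.linComp (.const _ x) (h.snd.fst.apply k.1))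

theorem regMapAt_sinkCoord (h : X.RegMapAt Ψ x) (α : I₀) :
    X.RegMapAt (fun y => sinkCoord (Ψ y) α) x :=
  RegMapAt.add (RegMapAt.linComp (h.snd.snd.apply (.inl α)) (.const (LinearMap.fst ℂ _ _) x))
    (RegMapAt.linComp (RegMapAt.sum Finset.univ fun k _ => RegMapAt.linComp
      (regMapAt_arrowCoord h k) (.const (LinearMap.proj k) x)) (.const (LinearMap.snd ℂ _ _) x))

end Regular

theorem isOpen_surjective_params [Finite I₀] : IsOpen {x : affineSpace (QuiverParam Ω v w w') |
    (∀ β, Function.Surjective ((Prod.snd x).2 (.inr β))) ∧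
      ∀ α, Function.Surjective (sinkCoord x α)} := by
  rw [isOpen_iff_mem_nhds]
  rintro x ⟨h₀, h₁⟩
  have hid : (affineSpace (QuiverParam Ω v w w')).RegMapAt (fun y : QuiverParam Ω v w w' => y) x :=
    regMapAt_id _
  exact Filter.Eventually.and
    (eventually_all.2 fun β => RegMapAt.eventually_surjective (hid.snd.snd.apply (.inr β)) (h₀ β))
    (eventually_all.2 fun α => RegMapAt.eventually_surjective (regMapAt_sinkCoord hid α) (h₁ α))

theorem exists_sinkCoord_eq
    (g : ∀ α, ((Fin (w' (.inl α)) → ℂ) × (∀ h : ArrowsTo Ω α, Fin (v (.inr h.1)) → ℂ)) →ₗ[ℂ]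
      (Fin (v (.inl α)) → ℂ)) (d : ∀ β, (Fin (w (.inr β)) → ℂ) →ₗ[ℂ] (Fin (v (.inr β)) → ℂ)) :
    ∃ x : QuiverParam Ω v w w', (∀ β, x.2.2 (.inr β) = d β) ∧ ∀ α, sinkCoord x α = g α := by
  classical
  let b : ∀ β, (Fin (v (.inr β)) → ℂ) →ₗ[ℂ] Middle (fun β (h : ArrowsFrom Ω β) => h.1)
      (fun β => Fin (w' (.inr β)) → ℂ) v β := fun β =>
    LinearMap.prod 0 (LinearMap.pi fun h => g h.1 ∘ₗ LinearMap.inr ℂ _ _ ∘ₗ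
      LinearMap.single ℂ (fun h : ArrowsTo Ω h.1 => Fin (v (.inr h.1)) → ℂ) ⟨β, h.2⟩)
  refine ⟨(0, b, fun | .inl α => g α ∘ₗ LinearMap.inl ℂ _ _ | .inr β => d β), fun _ => rfl,
    fun α => LinearMap.ext fun z => ?_⟩
  have hz : z = LinearMap.inl ℂ _ _ z.1 + ∑ h, LinearMap.inr ℂ _ _
      (LinearMap.single ℂ (fun h : ArrowsTo Ω α => Fin (v (.inr h.1)) → ℂ) h (z.2 h)) := by
    rw [← map_sum]
    simp only [LinearMap.coe_single, Finset.univ_sum_single]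
    ext <;> simp
  conv_rhs => rw [hz, map_add, map_sum]
  rw [sinkCoord_apply]
  rfl

variable [Fintype I₀]

/-! ### Irreducibility and dimension -/
theorem irreducibleSpace_nonsingularVariety (h : NonemptyCondition Ω v w w') :
    IrreducibleSpace (nonsingularVariety Ω v w w') := by
  rw [nonsingularVariety_eq]
  exact irreducibleSpace_bundle _ _ h.le_finrank_target h.le_finrank_middle

theorem isLocallyAffineSpace_nonsingularVariety {n : ℕ} (hn : (n : ℤ) = dimFtilde Ω v w w') :
    (nonsingularVariety Ω v w w').IsLocallyAffineSpace n := by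
  rw [nonsingularVariety_eq]
  refine isLocallyAffineSpace_bundle _ _ (hn.trans ?_)
  simp only [Module.finrank_fin_fun, dimFtilde, dimF, flagDim, sourceDim, Fintype.sum_sum_type,
    mul_comm]
  ring

theorem isLocallyAffineSpace_flagVariety {n : ℕ} (hn : (n : ℤ) = dimF Ω v w w') :
    (flagVariety Ω v w w').IsLocallyAffineSpace n := by
  rw [flagVariety_eq]
  refine isLocallyAffineSpace_flagSpace _ (hn.trans ?_)
  simp only [Module.finrank_fin_fun, dimF, flagDim, mul_comm]
  ring

theorem isNonsingular_nonsingularVariety (h : NonemptyCondition Ω v w w') :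
    (nonsingularVariety Ω v w w').IsNonsingular := by
  obtain ⟨n, hn⟩ := Int.eq_ofNat_of_zero_le h.dimFtilde_nonneg
  exact (isLocallyAffineSpace_nonsingularVariety hn.symm).isNonsingular

omit [Fintype I₁] in
theorem isNonsingular_flagVariety [Finite I₁] (h : NonemptyCondition Ω v w w') :
    (flagVariety Ω v w w').IsNonsingular := by
  have := Fintype.ofFinite I₁
  obtain ⟨n, hn⟩ := Int.eq_ofNat_of_zero_le h.dimF_nonneg
  exact (isLocallyAffineSpace_flagVariety hn.symm).isNonsingular

theorem hasDim_nonsingularVariety (h : NonemptyCondition Ω v w w') :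
    (nonsingularVariety Ω v w w').HasDim (dimFtilde Ω v w w') := by
  have := irreducibleSpace_nonsingularVariety h
  obtain ⟨n, hn⟩ := Int.eq_ofNat_of_zero_le h.dimFtilde_nonneg
  rw [hn]
  exact (isLocallyAffineSpace_nonsingularVariety hn.symm).hasDim

theorem hasDim_flagVariety (h : NonemptyCondition Ω v w w') :
    (flagVariety Ω v w w').HasDim (dimF Ω v w w') := by
  have := irreducibleSpace_flagVariety h
  obtain ⟨n, hn⟩ := Int.eq_ofNat_of_zero_le h.dimF_nonneg
  rw [hn]
  exact (isLocallyAffineSpace_flagVariety hn.symm).hasDim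

/-! ### Surjectivity of the projection -/

theorem isMorphismAt_proj (z : nonsingularVariety Ω v w w') :
    IsMorphismAt (proj Ω v w w') z :=
  IsMorphismAt.codRestrict
    ((isMorphismAt_affineProdGrassmannians_fst z.1).comp (IsMorphismAt.subVal _ z))

theorem continuous_proj : Continuous (proj Ω v w w') := (isMorphism_iff.2 isMorphismAt_proj).1

theorem proj_surjective (h : NonemptyCondition Ω v w w') :
    Function.Surjective (proj Ω v w w') := by
  rintro ⟨r, hr⟩
  have hsink : ∀ α, v (.inl α) ≤
      Module.finrank ℂ (⊤ : Submodule ℂ (Fin (w (.inl α)) → ℂ)) := fun α => by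
    rw [finrank_top, Module.finrank_fin_fun]
    exact h.1 α
  choose U hrU _ hU using fun α => exists_submodule_between (le_top (a := imA r (.inl α)))
    (hr (.inl α)) (hsink α)
  have hsource : ∀ β, v (.inr β) ≤
      Module.finrank ℂ (flagSpaceAt (Ω := Ω) (w' := w') U β) := fun β => by
    rw [finrank_flagSpaceAt]
    simp only [hU]
    exact h.2 β
  choose P hrP hPU hP using fun β => exists_submodule_between
    (range_sourceMap_le_flagSpaceAt hrU β) (hr (.inr β)) (hsource β)
  let X : GrPoint (Target Ω w w') v := ⟨fun | .inl α => U α | .inr β => P β, fun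
    | .inl α => hU α
    | .inr β => hP β⟩
  exact ⟨⟨(r, X), fun β z hz => mem_flagSpaceAt.1 (hPU β hz), fun
    | .inl α => hrU α
    | .inr β => hrP β⟩, rfl⟩

/-! ### Nonemptiness of strata -/

theorem exists_surjective_param (h : LDominant Ω v w w') :
    ∃ x : QuiverParam Ω v w w',
      (∀ β, Function.Surjective (x.2.2 (.inr β))) ∧ ∀ α, Function.Surjective (sinkCoord x α) := by
  rw [lDominant_iff] at h
  have hsource : ∀ β, Module.finrank ℂ (Fin (v (.inr β)) → ℂ) ≤
      Module.finrank ℂ (Fin (w (.inr β)) → ℂ) := fun β => by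
    simpa only [Module.finrank_fin_fun] using (h (.inr β)).1
  have hsink : ∀ α, Module.finrank ℂ (Fin (v (.inl α)) → ℂ) ≤ Module.finrank ℂ
      ((Fin (w' (.inl α)) → ℂ) × (∀ h : ArrowsTo Ω α, Fin (v (.inr h.1)) → ℂ)) := fun α => by
    rw [Module.finrank_prod, Module.finrank_fin_fun, Module.finrank_fin_fun,
      Module.finrank_pi_fintype]
    simpa only [Module.finrank_fin_fun, adjSum] using (h (.inl α)).2
  choose d hd using fun β => exists_surjective_of_finrank_le (hsource β)
  choose g hg using fun α => exists_surjective_of_finrank_le (hsink α)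
  obtain ⟨x, hxd, hxg⟩ := exists_sinkCoord_eq g d
  exact ⟨x, fun β => (hxd β).symm ▸ hd β, fun α => (hxg α).symm ▸ hg α⟩

/-- Parameters with injective frames and parameters with surjective coordinates form nonempty open
subsets of an affine space, so that they have a common point. -/
theorem stratum_nonempty (h : LDominant Ω v w w') : (stratum Ω v w w').Nonempty := by
  obtain ⟨x, hx₁, hx₂⟩ := nonempty_preirreducible_inter isOpen_injective_params
    isOpen_surjective_params
    (exists_injective_param _ h.nonemptyCondition.le_finrank_target
      h.nonemptyCondition.le_finrank_middle)
    (exists_surjective_param h)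
  exact ⟨QuiverParam.rep x, rankA_rep hx₁.1 hx₁.2 hx₂.1 hx₂.2⟩

/-! ### The affine varieties -/

theorem affineVariety_vbar :
    affineVariety Ω v w w' = affineVariety Ω (vbar Ω v w w') w w' :=
  congrArg (repSpace Ω w w').sub affineSet_vbar

omit [Fintype I₀] in
theorem irreducibleSpace_affineVariety [Finite I₀] :
    IrreducibleSpace (affineVariety Ω v w w') := by
  have := Fintype.ofFinite I₀
  rw [affineVariety_vbar]
  have h := (lDominant_vbar (Ω := Ω) (v := v) (w := w) (w' := w')).nonemptyCondition
  have := irreducibleSpace_nonsingularVariety h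
  exact (proj_surjective h).irreducibleSpace continuous_proj

theorem isGreatest_stratum :
    IsGreatest {u | (stratum Ω u w w').Nonempty ∧ stratum Ω u w w' ⊆ affineSet Ω v w w'}
      (vbar Ω v w w') := by
  rw [affineSet_vbar]
  exact ⟨⟨stratum_nonempty lDominant_vbar, stratum_subset_affineSet⟩,
    fun u ⟨⟨r, hr⟩, hu⟩ i => (hr i).ge.trans (hu hr i)⟩

theorem dense_stratumIn_vbar : Dense (stratumIn Ω v w w' (vbar Ω v w w')) := by
  have := irreducibleSpace_affineVariety (Ω := Ω) (v := v) (w := w) (w' := w')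
  obtain ⟨r, hr⟩ := stratum_nonempty (lDominant_vbar (Ω := Ω) (v := v) (w := w) (w' := w'))
  exact (isOpen_stratumIn affineSet_vbar.subset).dense ⟨⟨r, isGreatest_stratum.1.2 hr⟩, hr⟩

theorem affineSet_eq_closure :
    affineSet Ω v w w' = closure (stratum Ω (vbar Ω v w w') w w') := by
  refine Subset.antisymm (fun r hr => ?_)
    (closure_minimal isGreatest_stratum.1.2 isClosed_affineSet)
  have hdense := dense_stratumIn_vbar (⟨r, hr⟩ : affineVariety Ω v w w')
  exact closure_mono (image_subset_iff.2 fun _ hz => hz) (closure_subtype.1 hdense)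

/-! ### Birationality of the projection -/

/-- The section `r ↦ (r, im A)` of the projection over the stratum `E°_{v,w}`. -/
def stratumSection (z : (affineVariety Ω v w w').sub (stratumIn Ω v w w' v)) :
    (nonsingularVariety Ω v w w').sub (proj Ω v w w' ⁻¹' stratumIn Ω v w w' v) :=
  ⟨⟨(z.1.1, ⟨imA z.1.1, z.2⟩), fun β _ hz => mem_flagSpaceAt.1
    (range_sourceMap_le_flagSpaceAt (fun _ => le_rfl) β hz), fun _ => le_rfl⟩, z.2⟩

/-- Near a given point, the spaces `im A_i` have the frames `A_i ∘ j_i` with fixed maps `j_i`. -/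
theorem isMorphismAt_stratumSection
    (z : (affineVariety Ω v w w').sub (stratumIn Ω v w w' v)) :
    IsMorphismAt stratumSection z := by
  refine IsMorphismAt.codRestrict (IsMorphismAt.codRestrict ?_)
  choose j₀ hj₀ using fun α => exists_injective_comp (f := sinkMap z.1.1 α) (z.2 (.inl α)).ge
  choose j₁ hj₁ using fun β => exists_injective_comp (f := sourceMap z.1.1 β) (z.2 (.inr β)).ge
  have hrep : ((affineVariety Ω v w w').sub (stratumIn Ω v w w' v)).RegMapAt
      (M := Rep Ω w w') (fun y => y.1.1) z :=
    (IsMorphismAt.subVal (X := affineVariety Ω v w w') _ z).regMapAt (M := Rep Ω w w')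
      ((IsMorphismAt.subVal (X := repSpace Ω w w') _ z.1).regMapAt (M := Rep Ω w w')
        (regMapAt_id (M := Rep Ω w w') _))
  have hsink := fun α => RegMapAt.linComp (regMapAt_sinkMap hrep α) (.const (j₀ α) z)
  have hsource := fun β => RegMapAt.linComp (regMapAt_sourceMap hrep β) (.const (j₁ β) z)
  let F : Rep Ω w w' → FrameMaps (Target Ω w w') v := fun r => fun
    | .inl α => sinkMap r α ∘ₗ j₀ α
    | .inr β => sourceMap r β ∘ₗ j₁ β
  refine isMorphismAt_of_frame_lift (Ψ := fun y => ((y.1.1 : Rep Ω w w'), F y.1.1))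
    (hrep.prodMk (RegMapAt.pi fun
      | .inl α => hsink α
      | .inr β => hsource β)) ?_
  filter_upwards [eventually_all.2 fun α => (hsink α).eventually_injective (hj₀ α),
    eventually_all.2 fun β => (hsource β).eventually_injective (hj₁ β)] with y hy₀ hy₁
  refine ⟨fun | .inl α => hy₀ α | .inr β => hy₁ β, Prod.ext rfl (Subtype.ext (funext fun
    | .inl α => ?_
    | .inr β => ?_))⟩
  · exact range_comp_eq_of_injective (hy₀ α) (y.2 (.inl α))
  · exact range_comp_eq_of_injective (hy₁ β) (y.2 (.inr β))

theorem stratumSection_restrictPreimage_proj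
    (y : (nonsingularVariety Ω v w w').sub (proj Ω v w w' ⁻¹' stratumIn Ω v w w' v)) :
    stratumSection (restrictPreimage (stratumIn Ω v w w' v) (proj Ω v w w') y) = y :=
  Subtype.ext (Subtype.ext (Prod.ext rfl (Subtype.ext (funext fun i =>
    Submodule.eq_of_le_of_finrank_eq (y.1.2.2 i) ((y.2 i).trans (y.1.1.2.2 i).symm)))))

theorem isIsomorphism_restrictPreimage_proj : IsIsomorphism
    (X := (nonsingularVariety Ω v w w').sub (proj Ω v w w' ⁻¹' stratumIn Ω v w w' v))
    (Y := (affineVariety Ω v w w').sub (stratumIn Ω v w w' v))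
    (restrictPreimage (stratumIn Ω v w w' v) (proj Ω v w w')) :=
  ⟨stratumSection, stratumSection_restrictPreimage_proj, fun _ => rfl,
    isMorphism_iff.2 fun y =>
      IsMorphismAt.codRestrict ((isMorphismAt_proj y.1).comp (IsMorphismAt.subVal _ y)),
    isMorphism_iff.2 isMorphismAt_stratumSection⟩

theorem isBirational_proj (h : LDominant Ω v w w') : IsBirational (proj Ω v w w') := by
  have := irreducibleSpace_nonsingularVariety h.nonemptyCondition
  have hopen : IsOpen (stratumIn Ω v w w' v) := isOpen_stratumIn Subset.rfl
  have hdense : Dense (stratumIn Ω v w w' v) := by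
    simpa only [vbar_eq_of_lDominant h] using
      dense_stratumIn_vbar (Ω := Ω) (v := v) (w := w) (w' := w')
  have hne : (proj Ω v w w' ⁻¹' stratumIn Ω v w w' v).Nonempty := by
    obtain ⟨r, hr⟩ := stratum_nonempty h
    obtain ⟨y, hy⟩ := proj_surjective h.nonemptyCondition ⟨r, stratum_subset_affineSet hr⟩
    exact ⟨y, mem_preimage.2 (hy ▸ hr)⟩
  exact ⟨isMorphism_iff.2 isMorphismAt_proj, _, _, mapsTo_preimage _ _,
    hopen.preimage continuous_proj, (hopen.preimage continuous_proj).dense hne, hopen, hdense,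
    isIsomorphism_restrictPreimage_proj⟩

theorem hasDim_affineVariety_of_lDominant (h : LDominant Ω v w w') :
    (affineVariety Ω v w w').HasDim (dimFtilde Ω v w w') := by
  have := irreducibleSpace_nonsingularVariety h.nonemptyCondition
  obtain ⟨n, hn⟩ := Int.eq_ofNat_of_zero_le h.nonemptyCondition.dimFtilde_nonneg
  rw [hn]
  exact IsLocallyAffineSpace.hasDim_of_isBirational (S := affineSet Ω v w w')
    (isLocallyAffineSpace_nonsingularVariety hn.symm) (isBirational_proj h)

theorem hasDim_affineVariety :
    (affineVariety Ω v w w').HasDim (dimFtilde Ω (vbar Ω v w w') w w') := by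
  rw [affineVariety_vbar]
  exact hasDim_affineVariety_of_lDominant lDominant_vbar

end GradedQuiver

open GradedQuiver in
theorem proposition3p6 {I₀ I₁ : Type} [Fintype I₀] [Fintype I₁]
    (Ω : I₁ → I₀ → Type) [∀ β α, Fintype (Ω β α)] (v w w' : I₀ ⊕ I₁ → ℕ) :
    -- `v̄` is the largest `l`-dominant vector below `v`
    IsGreatest {u | u ≤ v ∧ LDominant Ω u w w'} (vbar Ω v w w') ∧
    -- (a)
    (affineSet Ω v w w' = affineSet Ω (vbar Ω v w w') w w' ∧
      IrreducibleSpace (affineVariety Ω v w w') ∧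
      IsGreatest {u | (stratum Ω u w w').Nonempty ∧ stratum Ω u w w' ⊆ affineSet Ω v w w'}
        (vbar Ω v w w') ∧
      IsOpen {z : affineVariety Ω v w w' | z.1 ∈ stratum Ω (vbar Ω v w w') w w'} ∧
      affineSet Ω v w w' = closure (stratum Ω (vbar Ω v w w') w w')) ∧
    -- (b)
    (NonemptyCondition Ω v w w' →
      IrreducibleSpace (nonsingularVariety Ω v w w') ∧
      (nonsingularVariety Ω v w w').IsNonsingular ∧
      IrreducibleSpace (flagVariety Ω v w w') ∧
      (flagVariety Ω v w w').IsNonsingular ∧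
      Function.Surjective (proj Ω v w w') ∧
      (flagVariety Ω v w w').HasDim (dimF Ω v w w') ∧
      dimF Ω v w w' =
        ∑ α, (w (.inl α) : ℤ) * v (.inl α) + ∑ β, (w' (.inr β) : ℤ) * v (.inr β)
          - ∑ i, (v i : ℤ) ^ 2 + ∑ β, ∑ α, ∑ _h : Ω β α, (v (.inr β) : ℤ) * v (.inl α) ∧
      (nonsingularVariety Ω v w w').HasDim (dimFtilde Ω v w w') ∧
      dimFtilde Ω v w w' =
        ∑ α, ((w (.inl α) : ℤ) + w' (.inl α)) * v (.inl α)
          + ∑ β, ((w (.inr β) : ℤ) + w' (.inr β)) * v (.inr β)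
          - ∑ i, (v i : ℤ) ^ 2 + ∑ β, ∑ α, ∑ _h : Ω β α, (v (.inr β) : ℤ) * v (.inl α) ∧
      (affineVariety Ω v w w').HasDim (dimFtilde Ω (vbar Ω v w w') w w') ∧
      (affineVariety Ω (vbar Ω v w w') w w').HasDim (dimFtilde Ω (vbar Ω v w w') w w')) ∧
    -- (c)
    (LDominant Ω v w w' →
      FunctionSpace.IsBirational (proj Ω v w w') ∧
      FunctionSpace.IsIsomorphism
        (X := (nonsingularVariety Ω v w w').sub
          (proj Ω v w w' ⁻¹' {z : affineVariety Ω v w w' | z.1 ∈ stratum Ω v w w'}))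
        (Y := (affineVariety Ω v w w').sub
          {z : affineVariety Ω v w w' | z.1 ∈ stratum Ω v w w'})
        (Set.restrictPreimage {z : affineVariety Ω v w w' | z.1 ∈ stratum Ω v w w'}
          (proj Ω v w w'))) := by
  refine ⟨isGreatest_vbar, ⟨affineSet_vbar, irreducibleSpace_affineVariety, isGreatest_stratum,
    isOpen_stratumIn affineSet_vbar.subset, affineSet_eq_closure⟩, fun h => ?_, fun h =>
    ⟨isBirational_proj h, isIsomorphism_restrictPreimage_proj⟩⟩
  exact ⟨irreducibleSpace_nonsingularVariety h, isNonsingular_nonsingularVariety h,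
    irreducibleSpace_flagVariety h, isNonsingular_flagVariety h, proj_surjective h,
    hasDim_flagVariety h, dimF_eq Ω v w w', hasDim_nonsingularVariety h, dimFtilde_eq Ω v w w',
    hasDim_affineVariety, hasDim_affineVariety_of_lDominant lDominant_vbar⟩
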